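/- Let $K$ be a field of characteristic $0$, $F=K((t))$, $O=K[[t]]$, and let $\omega=F\,dt$ be the one-dimensional $F$-space of (continuous) Kähler differentials of $F/K$. Let $V$ be an $F$-vector space of finite dimension $n$ with a $K$-linear connection $\nabla:V\to\omega\otimes_F V$, $\nabla(fx)=df\otimes x+f\nabla x$. For $0\ne\nu\in\omega$ let $v(\nu)$ be its valuation ($\nu=ct^{v(\nu)}dt+{}$higher order terms, $c\neq0$), let $\tau_\nu=\nu^{-1}\in\mathrm{Hom}_F(\omega,F)$ be the vector field with $\tau_\nu(\nu)=1$, and let $\nabla(\tau_\nu):V\to V$ be the covariant derivative along it. Consider $V$ as a Tate $K$-vector space, the $O$-submodules generating $V$ over $F$ being a base of neighbourhoods of $0$. A c-lattice is an open $K$-subspace $L\subset V$ whose image in $V/U$ is finite-dimensional for every open subspace $U$. Asymptotic morphisms of $K$-vector spaces are linear maps modulo maps of finite rank, and $V^\infty$ is the object of the resulting category represented by $V/L$ for any c-lattice $L$; the operator $\nabla(\tau_\nu)$ induces, through a linear section $V/L\to V$ of the projection, an asymptotic endomorphism $\nabla(\tau_\nu)^\infty$ of $V^\infty$. For an invertible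 asymptotic morphism $\varphi:N\to M$, the $\mathbb Z$-graded super line $\det(M,N,\varphi)$ is $\det P\otimes(\det Q)^{-1}$, where $f:N\to M$ is a linear map representing $\varphi$, $P\subset M$ is a finite-dimensional subspace with $P+f(N)=M$, $Q=f^{-1}(P)$, and $\det$ of a finite-dimensional space is its top exterior power placed in degree equal to its dimension. Let $\delta=\nabla(t\partial_t)$. A cyclic vector is an $e\in V$ such that the vectors $\delta^je$ ($j\ge0$) span $V$ over $F$; then $\delta^ne=\sum_{i<n}a_i\delta^ie$ with unique $a_i\in F$, and the irregularity $i(\nabla)$ is the height $\sup(0,-v(a_0),\dots,-v(a_{n-1}))$ of the Newton polygon of the operator $\delta^n-\sum_i a_i\delta^i$. **Corollary 4.3.** Cyclic vectors exist and all of them give the same value of $i(\nabla)$. C-lattices in $V$ exist, and for every nonzero $\nu\in\omega$ the asymptotic operator $\nabla(\tau_\nu)^\infty$ on $V^\infty$ is invertible, so that the $\varepsilon$-line $\mathcal E(V,\nabla)_\nu=\det(V^\infty,\nabla(\tau_\nu)^\infty)$ is defined (computed with any c-lattice $L$). It has degree $$i(\nabla)+(v(\nu)+1)\,n .$$ -/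

import Mathlib

open scoped TensorProduct LaurentSeries PowerSeries

noncomputable section

namespace EpsilonLine

universe u v w

/-! ### Differential forms, vector fields and connections on the formal punctured disc -/

/-- The one-dimensional `K((t))`-vector space `ω = K((t)) dt` of (continuous) Kähler
differentials of `K((t))` over `K`.  The Laurent series `f` stands for the form `f dt`. -/
def Form (K : Type u) [Field K] : Type u := K⸨X⸩

instance (K : Type u) [Field K] : AddCommGroup (Form K) :=
  inferInstanceAs (AddCommGroup K⸨X⸩)

instance (K : Type u) [Field K] : Module K⸨X⸩ (Form K) :=
  inferInstanceAs (Module K⸨X⸩ K⸨X⸩)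

instance (K : Type u) [Field K] : Module K (Form K) :=
  inferInstanceAs (Module K K⸨X⸩)

instance (K : Type u) [Field K] : IsScalarTower K K⸨X⸩ (Form K) where
  smul_assoc c f g := by
    change (c • f) * (show K⸨X⸩ from g) = c • (f * (show K⸨X⸩ from g))
    rw [← HahnSeries.C_mul_eq_smul, ← HahnSeries.C_mul_eq_smul, mul_assoc]

instance (K : Type u) [Field K] : SMulCommClass K⸨X⸩ K (Form K) where
  smul_comm f c g := by
    change f * (c • (show K⸨X⸩ from g)) = c • (f * (show K⸨X⸩ from g))
    rw [← HahnSeries.C_mul_eq_smul, ← HahnSeries.C_mul_eq_smul, mul_left_comm]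

/-- `coeffDt (f dt) = f`. -/
def coeffDt (K : Type u) [Field K] : Form K ≃ₗ[K⸨X⸩] K⸨X⸩ := LinearEquiv.refl _ _

/-- The universal differential `d : K((t)) → ω`, `f ↦ f' dt`. -/
def dForm (K : Type u) [Field K] (f : K⸨X⸩) : Form K :=
  (coeffDt K).symm (LaurentSeries.derivative K f)

/-- The valuation of a form: `v(c t^m dt + higher order terms) = m` for `c ≠ 0`. -/
def Form.valuation {K : Type u} [Field K] (ν : Form K) : ℤ := (coeffDt K ν).order

/-- Vector fields on the punctured disc, `Der(F/K) = Hom_F(ω, F)` with `F = K((t))`. -/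
abbrev VectorField (K : Type u) [Field K] : Type u := Form K →ₗ[K⸨X⸩] K⸨X⸩

/-- The vector field `τ_ν = ν⁻¹`: the functional on `ω` that sends `ν` to `1`
(for `ν ≠ 0`). -/
def tau {K : Type u} [Field K] (ν : Form K) : VectorField K :=
  (coeffDt K ν)⁻¹ • (coeffDt K).toLinearMap

theorem tau_self {K : Type u} [Field K] {ν : Form K} (hν : ν ≠ 0) : tau ν ν = 1 := by
  have h : coeffDt K ν ≠ 0 := by simpa using hν
  simp [tau, h]

/-- The form `dt / t`. -/
def dlogT (K : Type u) [Field K] : Form K :=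
  (coeffDt K).symm (HahnSeries.single (-1) 1)

section Connections

variable (K : Type u) [Field K] (V : Type v) [AddCommGroup V] [Module K⸨X⸩ V]
  [Module K V] [IsScalarTower K K⸨X⸩ V]

/-- A (`K`-relative) connection `∇ : V → ω ⊗_F V` on an `F`-vector space, `F = K((t))`. -/
structure Connection where
  /-- The underlying `K`-linear map. -/
  toLinearMap : V →ₗ[K] Form K ⊗[K⸨X⸩] V
  leibniz : ∀ (f : K⸨X⸩) (x : V),
    toLinearMap (f • x) = dForm K f ⊗ₜ[K⸨X⸩] x + f • toLinearMap x

variable {K V}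

/-- The operator `∇(τ) : V → V` of covariant derivative along a vector field `τ`, i.e. the
composition of `∇` with the contraction `τ ⊗ id : ω ⊗ V → F ⊗ V = V`. -/
def Connection.along (nabla : Connection K V) (τ : VectorField K) : V →ₗ[K] V :=
  (((TensorProduct.lid K⸨X⸩ V).toLinearMap ∘ₗ LinearMap.rTensor V τ).restrictScalars K) ∘ₗ
    nabla.toLinearMap

/-! ### Irregularity -/

/-- `δ = ∇(t ∂_t)`. -/
def Connection.delta (nabla : Connection K V) : V →ₗ[K] V := nabla.along (tau (dlogT K))

/-- `e` generates `V` as a module over the differential operators, and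
`δⁿ e = a_{n-1} δ^{n-1} e + ⋯ + a_0 e` with `n = dim_F V`; so
`V` is presented by the differential operator `δⁿ - ∑ aᵢ δⁱ`. -/
def Connection.IsCyclicEquation (nabla : Connection K V) (e : V)
    (a : Fin (Module.finrank K⸨X⸩ V) → K⸨X⸩) : Prop :=
  Submodule.span K⸨X⸩ (Set.range fun i : ℕ => (nabla.delta ^ i) e) = ⊤ ∧
    (nabla.delta ^ Module.finrank K⸨X⸩ V) e =
      ∑ i, a i • (nabla.delta ^ (i : ℕ)) e

/-- The height of the Newton polygon of the operator `δⁿ - ∑ aᵢ δⁱ` (equivalently the sum of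
its slopes, counted with multiplicity), namely `sup (0, -v(aᵢ))`.
The order of the zero series is `0` in Mathlib, so zero coefficients do not contribute. -/
def newtonHeight {n : ℕ} (a : Fin n → K⸨X⸩) : ℕ :=
  Finset.univ.sup fun i => (-(a i).order).toNat

/-- The irregularity of `∇`: the height of the Newton polygon of the differential operator
attached to a cyclic vector of `V` (all cyclic vectors give the same number). -/
def Connection.irregularity (nabla : Connection K V) : ℕ :=
  sInf {r | ∃ e a, nabla.IsCyclicEquation e a ∧ r = newtonHeight a}

/-! ### The Tate vector space `V` and its c-lattices -/

variable (K) in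
/-- Open `K`-subspaces of a finite-dimensional `F`-vector space `V`: the topology of `V` has as
a base at `0` the `K[[t]]`-submodules that generate `V` over `F`. -/
def IsOpenSubspace (U : Submodule K V) : Prop :=
  ∃ S : Submodule K V, (∀ (a : K⟦X⟧), ∀ x ∈ S, (a : K⸨X⸩) • x ∈ S) ∧
    Submodule.span K⸨X⸩ (S : Set V) = ⊤ ∧ S ≤ U

variable (K) in
/-- Bounded subspaces: those with finite-dimensional image in every discrete quotient. -/
def IsBoundedSubspace (L : Submodule K V) : Prop :=
  ∀ U : Submodule K V, IsOpenSubspace K U → FiniteDimensional K (L.map U.mkQ)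

variable (K) in
/-- A c-lattice is a bounded open subspace (over a field, `V / L` is always projective). -/
def IsCLattice (L : Submodule K V) : Prop := IsOpenSubspace K L ∧ IsBoundedSubspace K L

end Connections

/-! ### Asymptotic morphisms -/

section Asymptotic

variable (K : Type u) [Field K] (N M L : Type v) [AddCommGroup N] [Module K N]
  [AddCommGroup M] [Module K M] [AddCommGroup L] [Module K L]

/-- Linear maps of finite rank. -/
def finiteRankHom : Submodule K (N →ₗ[K] M) where
  carrier := {f | FiniteDimensional K (LinearMap.range f)}
  zero_mem' := by
    change FiniteDimensional K (LinearMap.range (0 : N →ₗ[K] M))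
    rw [LinearMap.range_zero]; infer_instance
  add_mem' := by
    intro f g hf hg
    have hf' : FiniteDimensional K (LinearMap.range f) := hf
    have hg' : FiniteDimensional K (LinearMap.range g) := hg
    exact Submodule.finiteDimensional_of_le (LinearMap.range_add_le f g)
  smul_mem' := by
    intro c f hf
    have hf' : FiniteDimensional K (LinearMap.range f) := hf
    have hle : LinearMap.range (c • f) ≤ LinearMap.range f := by
      rintro _ ⟨x, rfl⟩
      exact ⟨c • x, by simp⟩
    exact Submodule.finiteDimensional_of_le hle

/-- Asymptotic morphisms `N → M`: linear maps modulo maps of finite rank. -/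
abbrev AsympHom : Type v := (N →ₗ[K] M) ⧸ finiteRankHom K N M

variable {K N M L}

/-- The asymptotic morphism `f^∞` of a linear map `f`. -/
def asymp (f : N →ₗ[K] M) : AsympHom K N M := (finiteRankHom K N M).mkQ f

theorem asymp_eq_iff (f g : N →ₗ[K] M) :
    asymp f = asymp g ↔ FiniteDimensional K (LinearMap.range (f - g)) :=
  Submodule.Quotient.eq _

/-- Composition of asymptotic morphisms, induced by composition of linear maps. -/
def AsympHom.comp (ψ : AsympHom K M L) (φ : AsympHom K N M) : AsympHom K N L :=
  Quotient.liftOn₂' ψ φ (fun g f => asymp (g ∘ₗ f)) (by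
    intro g f g' f' hg hf
    have hg1 : FiniteDimensional K (LinearMap.range (g - g')) :=
      (asymp_eq_iff g g').1 (Quotient.sound' hg)
    have hf1 : FiniteDimensional K (LinearMap.range (f - f')) :=
      (asymp_eq_iff f f').1 (Quotient.sound' hf)
    rw [asymp_eq_iff]
    have h2 : FiniteDimensional K ((LinearMap.range (f - f')).map g') := inferInstance
    have hle : LinearMap.range (g ∘ₗ f - g' ∘ₗ f') ≤
        LinearMap.range (g - g') ⊔ (LinearMap.range (f - f')).map g' := by
      rintro _ ⟨x, rfl⟩
      refine Submodule.mem_sup.2 ⟨(g - g') (f x), ⟨f x, rfl⟩, g' ((f - f') x),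
        ⟨(f - f') x, ⟨x, rfl⟩, rfl⟩, ?_⟩
      simp
    exact Submodule.finiteDimensional_of_le hle)

theorem asymp_comp (g : M →ₗ[K] L) (f : N →ₗ[K] M) :
    (asymp g).comp (asymp f) = asymp (g ∘ₗ f) := rfl

/-- Invertible asymptotic morphisms. -/
def AsympHom.IsIso (φ : AsympHom K N M) : Prop :=
  ∃ ψ : AsympHom K M N, ψ.comp φ = asymp LinearMap.id ∧ φ.comp ψ = asymp LinearMap.id

end Asymptotic

/-! ### Graded super lines and relative determinant lines -/

/-- A `ℤ`-graded super line over `K`: a line placed in an integral degree (its parity is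
the degree modulo `2`). -/
structure GradedLine (K : Type u) [Field K] where
  /-- The underlying one-dimensional vector space. -/
  carrier : Type w
  [addCommGroup : AddCommGroup carrier]
  [module : Module K carrier]
  finrank_eq_one : Module.finrank K carrier = 1
  /-- The degree of the line. -/
  degree : ℤ

attribute [instance] GradedLine.addCommGroup GradedLine.module

section DetLines

variable {K : Type u} [Field K]

/-- The tensor product of graded lines. -/
def GradedLine.mul (A B : GradedLine.{u, w} K) : GradedLine.{u, w} K where
  carrier := A.carrier ⊗[K] B.carrier
  finrank_eq_one := by
    rw [Module.finrank_tensorProduct, A.finrank_eq_one, B.finrank_eq_one]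
  degree := A.degree + B.degree

/-- The inverse of a graded line. -/
def GradedLine.inv (A : GradedLine.{u, max u w} K) : GradedLine.{u, max u w} K where
  carrier := Module.Dual K A.carrier
  finrank_eq_one := by rw [Subspace.dual_finrank_eq, A.finrank_eq_one]
  degree := -A.degree

/-- `det P`: the top exterior power of a finite-dimensional space, in degree `dim P`. -/
def detSpace (K : Type u) [Field K] (P : Type v) [AddCommGroup P] [Module K P]
    [FiniteDimensional K P] : GradedLine.{u, max u v} K where
  carrier := ⋀[K]^(Module.finrank K P) P
  finrank_eq_one := by rw [exteriorPower.finrank_eq, Nat.choose_self]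
  degree := Module.finrank K P

variable {N M : Type v} [AddCommGroup N] [Module K N] [AddCommGroup M] [Module K M]

/-- The choices used to compute the relative determinant line of an asymptotic isomorphism
`φ : N → M`: a lifting `f : N → M` of `φ` and a finite-dimensional `P ⊆ M` with
`P + f(N) = M` (then `Q = f⁻¹(P)` is finite-dimensional as well). -/
structure DetDatum (φ : AsympHom K N M) where
  /-- The lifting. -/
  f : N →ₗ[K] M
  asymp_f : asymp f = φ
  /-- The finite-dimensional subspace of the target. -/
  P : Submodule K M
  finite_P : FiniteDimensional K P
  sup_range : P ⊔ LinearMap.range f = ⊤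
  finite_Q : FiniteDimensional K (P.comap f)

/-- The graded line `det P / det Q` with `Q = f⁻¹(P)`. -/
def DetDatum.line {φ : AsympHom K N M} (D : DetDatum φ) : GradedLine.{u, max u v} K :=
  haveI := D.finite_P
  haveI := D.finite_Q
  (detSpace K D.P).mul (GradedLine.inv.{u, v} (detSpace K (D.P.comap D.f)))

theorem DetDatum.nonempty {φ : AsympHom K N M} (hφ : φ.IsIso) : Nonempty (DetDatum φ) := by
  obtain ⟨ψ, h1, h2⟩ := hφ
  obtain ⟨f, rfl⟩ := Submodule.mkQ_surjective _ φ
  obtain ⟨g, rfl⟩ := Submodule.mkQ_surjective _ ψ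
  have k1 : FiniteDimensional K (LinearMap.range (g ∘ₗ f - LinearMap.id)) :=
    (asymp_eq_iff _ _).1 h1
  have k2 : FiniteDimensional K (LinearMap.range (f ∘ₗ g - LinearMap.id)) :=
    (asymp_eq_iff _ _).1 h2
  refine ⟨⟨f, rfl, LinearMap.range (f ∘ₗ g - LinearMap.id), k2, ?_, ?_⟩⟩
  · rw [eq_top_iff]
    intro y _
    refine Submodule.mem_sup.2 ⟨-(f (g y) - y),
      Submodule.neg_mem _ ⟨y, by simp⟩, f (g y), ⟨g y, rfl⟩, ?_⟩
    simp
  · have hle : (LinearMap.range (f ∘ₗ g - LinearMap.id)).comap f ≤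
        (LinearMap.range (f ∘ₗ g - LinearMap.id)).map g ⊔
          LinearMap.range (g ∘ₗ f - LinearMap.id) := by
      intro x hx
      refine Submodule.mem_sup.2 ⟨g (f x), ⟨f x, hx, rfl⟩, -(g (f x) - x),
        Submodule.neg_mem _ ⟨x, by simp⟩, ?_⟩
      simp
    have k3 : FiniteDimensional K ((LinearMap.range (f ∘ₗ g - LinearMap.id)).map g) :=
      inferInstance
    exact Submodule.finiteDimensional_of_le hle

/-- The relative determinant line `det(M, N, φ)` of an asymptotic isomorphism `φ : N → M`.
The lines attached to the various data are canonically isomorphic; one of them is chosen. -/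
def relDet (φ : AsympHom K N M) (hφ : φ.IsIso) : GradedLine.{u, max u v} K :=
  (DetDatum.nonempty hφ).some.line

end DetLines

/-! ### The `ε`-line -/

section EpsilonLines

variable {K : Type u} [Field K] {V : Type v} [AddCommGroup V] [Module K V]

/-- For a c-lattice `L`, the object `V^∞` is represented by `V / L`.  A continuous operator
`g` on `V` acts on it by the asymptotic class of `V / L → V → V → V / L`, where the first map
is any linear section of the projection (the class does not depend on the section). -/
def asympOperator (L : Submodule K V) (g : V →ₗ[K] V) : AsympHom K (V ⧸ L) (V ⧸ L) :=
  asymp (L.mkQ ∘ₗ g ∘ₗ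
    (L.mkQ.exists_rightInverse_of_surjective L.range_mkQ).choose)

variable [Module K⸨X⸩ V] [IsScalarTower K K⸨X⸩ V]

/-- The asymptotic operator `∇(τ_ν)^∞` on `V^∞`, with `V^∞` represented by `V / L`. -/
def Connection.tauInfty (nabla : Connection K V) (ν : Form K) (L : Submodule K V) :
    AsympHom K (V ⧸ L) (V ⧸ L) :=
  asympOperator L (nabla.along (tau ν))

/-- The `ε`-line `ℰ(V, ∇)_ν = det(V^∞, ∇(τ_ν)^∞)`, with `V^∞` represented by `V / L`. -/
def Connection.epsilonLine (nabla : Connection K V) (ν : Form K) (L : Submodule K V)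
    (h : (nabla.tauInfty ν L).IsIso) : GradedLine.{u, max u v} K :=
  relDet (nabla.tauInfty ν L) h

end EpsilonLines

end EpsilonLine

end

/-!
The degree of the relative determinant line of an asymptotic automorphism `φ` is minus the index
`dim ker f - dim coker f` of any linear map `f` representing `φ`: passing to the quotient by the
chosen finite-dimensional `P` makes `f` surjective with kernel `Q` (`relDet_degree`). So the theorem
is an index computation. The index of the operator induced on `V / L'` does not feel the choice of
the c-lattice `L'`: as soon as some c-lattices `L` and `M` have the property that `g = ∇(τ_ν)`
induces a bijection `V / L → V / M`, the index is minus the relative dimension `[M : L]`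
(`hasIndex_section_of_bijective`).

Such `L` and `M` are found in the basis `δⁱ e` given by a cyclic vector `e`. Let `θ = t d/dt`,
`δⁿ e = ∑ aᵢ δⁱ e`, and let `r` be the Newton height of `a`. Modulo the image of `δ` every vector is
a multiple of `e`, and in this way `δ` on `V` becomes the formal adjoint
`D f = (-θ)ⁿ f - ∑ (-θ)ⁱ (aᵢ f)` on `K((t))`. On leading terms, `D` sends `c t^k` to
`p(r - k) c t^(k - r)` for a nonzero polynomial `p`. In characteristic zero `p(r - k) ≠ 0` for all
sufficiently negative `k`, so `D` is bijective from `K((t)) / t^N K[[t]]` to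
`K((t)) / t^(N - r) K[[t]]` for some `N`. Accordingly `δ` is bijective from `V / L` to `V / M`,
where `M` is `t^(N - r)` times the standard lattice and `L ⊆ M` has last coordinates in `t^N K[[t]]`
instead (`delta_bijective_of_cyclic_basis`). The codimension of `L` in `M` is `r`. Since
`∇(τ_ν) = w δ` with `w` of order `-(v(ν) + 1)`, the general case replaces `M` by `w M`, which
contributes `(v(ν) + 1) n`.

As the degree is independent of `e`, all cyclic vectors give the same `r`. A cyclic vector exists by
Deligne's perturbation argument: if `e, δ e, …, δ^(m-1) e` are independent with `m < n` but
`δ^m e` depends on them, then `e + c t^k f` has one more independent derivative for a suitable `f`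
outside their span, a suitable `k` and generic `c` (`IsThetaLinear.exists_linearIndependent_succ`).
-/

noncomputable section

namespace EpsilonLine

universe u v

/-! ### The index of a linear map with finite-dimensional kernel and cokernel -/

section FredholmIndex

variable {K : Type u} [Field K] {A N M B : Type v} [AddCommGroup A] [Module K A]
  [AddCommGroup N] [Module K N] [AddCommGroup M] [Module K M] [AddCommGroup B] [Module K B]

/-- `f` is Fredholm of index `d`: it has finite-dimensional kernel and cokernel, and
`dim ker f - dim coker f = d`. -/
structure HasIndex (f : N →ₗ[K] M) (d : ℤ) : Prop where
  finite_ker : FiniteDimensional K (LinearMap.ker f)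
  finite_coker : FiniteDimensional K (M ⧸ LinearMap.range f)
  index_eq : (Module.finrank K (LinearMap.ker f) : ℤ) -
    Module.finrank K (M ⧸ LinearMap.range f) = d

theorem HasIndex.unique {f : N →ₗ[K] M} {d d' : ℤ} (h : HasIndex f d) (h' : HasIndex f d') :
    d = d' :=
  h.index_eq.symm.trans h'.index_eq

theorem hasIndex_of_surjective {f : N →ₗ[K] M} (hf : Function.Surjective f)
    [FiniteDimensional K (LinearMap.ker f)] :
    HasIndex f (Module.finrank K (LinearMap.ker f)) := by
  have h : LinearMap.range f = ⊤ := LinearMap.range_eq_top.2 hf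
  have : Subsingleton (M ⧸ LinearMap.range f) := Submodule.Quotient.subsingleton_iff.2 h
  exact ⟨inferInstance, inferInstance, by simp [Module.finrank_zero_of_subsingleton]⟩

theorem hasIndex_of_bijective {f : N →ₗ[K] M} (hf : Function.Bijective f) : HasIndex f 0 := by
  have h : LinearMap.ker f = ⊥ := LinearMap.ker_eq_bot.2 hf.1
  have : FiniteDimensional K (LinearMap.ker f) := by rw [h]; infer_instance
  have := hasIndex_of_surjective hf.2
  rwa [h, finrank_bot] at this

theorem finiteDimensional_comap (f : N →ₗ[K] M) [FiniteDimensional K (LinearMap.ker f)]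
    (P : Submodule K M) [FiniteDimensional K P] : FiniteDimensional K (P.comap f) := by
  refine Module.Finite.iff_fg.2 (Submodule.fg_of_fg_map_of_fg_inf_ker f ?_ ?_)
  · exact Module.Finite.iff_fg.1 (Submodule.finiteDimensional_of_le (Submodule.map_comap_le f P))
  · exact Module.Finite.iff_fg.1
      (Submodule.finiteDimensional_of_le (inf_le_right : _ ≤ LinearMap.ker f))

theorem finrank_comap (f : N →ₗ[K] M) [FiniteDimensional K (LinearMap.ker f)]
    (P : Submodule K M) [FiniteDimensional K P] :
    Module.finrank K (P.comap f) =
      Module.finrank K (LinearMap.ker f) + Module.finrank K ↥(P ⊓ LinearMap.range f) := by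
  have := finiteDimensional_comap f P
  have h := LinearMap.finrank_range_add_finrank_ker (f.domRestrict (P.comap f))
  rw [LinearMap.range_domRestrict, Submodule.map_comap_eq, LinearMap.ker_domRestrict] at h
  rw [← h, inf_comm, add_comm]
  congr 1
  exact (Submodule.comapSubtypeEquivOfLe (LinearMap.ker_le_comap f)).finrank_eq

/-- Composing with a surjection of finite-dimensional kernel on the source side shifts the
index by the dimension of that kernel. -/
theorem hasIndex_comp_surjective (f : N →ₗ[K] M) {p : A →ₗ[K] N} (hp : Function.Surjective p)
    [FiniteDimensional K (LinearMap.ker p)] (d : ℤ) :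
    HasIndex (f ∘ₗ p) d ↔ HasIndex f (d - Module.finrank K (LinearMap.ker p)) := by
  have hr : LinearMap.range (f ∘ₗ p) = LinearMap.range f :=
    LinearMap.range_comp_of_range_eq_top f (LinearMap.range_eq_top.2 hp)
  have hk : LinearMap.ker (f ∘ₗ p) = (LinearMap.ker f).comap p := LinearMap.ker_comp p f
  have hdim [FiniteDimensional K (LinearMap.ker f)] :
      Module.finrank K (LinearMap.ker (f ∘ₗ p)) =
        Module.finrank K (LinearMap.ker p) + Module.finrank K (LinearMap.ker f) := by
    rw [hk, finrank_comap, LinearMap.range_eq_top.2 hp, inf_top_eq]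
  constructor
  · rintro ⟨h1, h2, h3⟩
    have : FiniteDimensional K (LinearMap.ker f) := by
      have h4 : LinearMap.ker f = (LinearMap.ker (f ∘ₗ p)).map p := by
        rw [hk, Submodule.map_comap_eq_of_surjective hp]
      rw [h4]; infer_instance
    rw [hr] at h2 h3
    exact ⟨this, h2, by rw [← h3, hdim]; push_cast; ring⟩
  · rintro ⟨h1, h2, h3⟩
    have h4 := hdim
    rw [← hr] at h2 h3
    exact ⟨by rw [hk]; exact finiteDimensional_comap p _, h2, by
      rw [h4]; push_cast; linarith⟩

/-- Composing with a surjection of finite-dimensional kernel on the target side shifts the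
index by the dimension of that kernel. -/
theorem hasIndex_surjective_comp (f : N →ₗ[K] M) {q : M →ₗ[K] B} (hq : Function.Surjective q)
    [FiniteDimensional K (LinearMap.ker q)] (d : ℤ) :
    HasIndex (q ∘ₗ f) d ↔ HasIndex f (d - Module.finrank K (LinearMap.ker q)) := by
  have hk : LinearMap.ker (q ∘ₗ f) = (LinearMap.ker q).comap f := LinearMap.ker_comp f q
  -- the cokernel of `q ∘ f` is the quotient of `coker f` by the image of `ker q`
  let e₁ : ((M ⧸ LinearMap.range f) ⧸ (LinearMap.ker q).map (LinearMap.range f).mkQ) ≃ₗ[K]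
      B ⧸ LinearMap.range (q ∘ₗ f) :=
    (Submodule.quotientQuotientEquivQuotientSup _ _).trans
      ((Submodule.quotEquivOfEq _ _ (by
        rw [LinearMap.ker_comp, Submodule.ker_mkQ, LinearMap.range_comp,
          Submodule.comap_map_eq])).trans
        (((LinearMap.range (q ∘ₗ f)).mkQ ∘ₗ q).quotKerEquivOfSurjective
          ((Submodule.mkQ_surjective _).comp hq)))
  have hP : Module.finrank K ((LinearMap.ker q).map (LinearMap.range f).mkQ) +
      Module.finrank K ↥(LinearMap.ker q ⊓ LinearMap.range f) =
        Module.finrank K (LinearMap.ker q) := by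
    have h := LinearMap.finrank_range_add_finrank_ker
      ((LinearMap.range f).mkQ.domRestrict (LinearMap.ker q))
    rw [LinearMap.range_domRestrict, LinearMap.ker_domRestrict, Submodule.ker_mkQ] at h
    rw [← h]
    congr 1
    rw [← (Submodule.equivMapOfInjective (LinearMap.ker q).subtype
      (Submodule.subtype_injective _) ((LinearMap.range f).comap _)).finrank_eq.symm,
      Submodule.map_comap_subtype]
  have hker : FiniteDimensional K (LinearMap.ker (q ∘ₗ f)) ↔
      FiniteDimensional K (LinearMap.ker f) := by
    constructor
    · intro h
      exact Submodule.finiteDimensional_of_le (LinearMap.ker_le_ker_comp f q)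
    · intro h
      rw [hk]
      exact finiteDimensional_comap f _
  have hcoker : FiniteDimensional K (B ⧸ LinearMap.range (q ∘ₗ f)) ↔
      FiniteDimensional K (M ⧸ LinearMap.range f) := by
    constructor
    · intro h
      have := Module.Finite.equiv e₁.symm
      exact Module.Finite.of_submodule_quotient ((LinearMap.ker q).map (LinearMap.range f).mkQ)
    · intro h
      exact Module.Finite.equiv e₁
  have hdim : FiniteDimensional K (LinearMap.ker f) →
      FiniteDimensional K (M ⧸ LinearMap.range f) →
      ((Module.finrank K (LinearMap.ker (q ∘ₗ f)) : ℤ) -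
        Module.finrank K (B ⧸ LinearMap.range (q ∘ₗ f))) =
      Module.finrank K (LinearMap.ker f) - Module.finrank K (M ⧸ LinearMap.range f) +
        Module.finrank K (LinearMap.ker q) := by
    intro h1 h2
    have h3 := Submodule.finrank_quotient_add_finrank
      ((LinearMap.ker q).map (LinearMap.range f).mkQ)
    rw [e₁.finrank_eq] at h3
    rw [hk, finrank_comap]
    omega
  constructor
  · rintro ⟨h1, h2, h3⟩
    have h1' := hker.1 h1
    have h2' := hcoker.1 h2
    exact ⟨h1', h2', by have := hdim h1' h2'; linarith⟩
  · rintro ⟨h1, h2, h3⟩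
    exact ⟨hker.2 h1, hcoker.2 h2, by rw [hdim h1 h2, h3]; ring⟩

/-- The index depends only on the asymptotic class. -/
theorem HasIndex.congr_asymp {f g : N →ₗ[K] M} {d : ℤ} (hf : HasIndex f d)
    (h : asymp f = asymp g) : HasIndex g d := by
  have hfin : FiniteDimensional K (LinearMap.range (f - g)) := (asymp_eq_iff f g).1 h
  set R := LinearMap.range (f - g) with hR
  have hk : FiniteDimensional K (LinearMap.ker R.mkQ) := by rwa [Submodule.ker_mkQ]
  -- `f` and `g` agree modulo the finite-dimensional image of their difference
  have heq : R.mkQ ∘ₗ f = R.mkQ ∘ₗ g := by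
    ext x
    exact (Submodule.Quotient.eq R).2 ⟨x, rfl⟩
  have h1 := hasIndex_surjective_comp f R.mkQ_surjective
    (d + Module.finrank K (LinearMap.ker R.mkQ))
  have h2 := hasIndex_surjective_comp g R.mkQ_surjective
    (d + Module.finrank K (LinearMap.ker R.mkQ))
  rw [add_sub_cancel_right] at h1 h2
  rw [heq] at h1
  exact h2.1 (h1.2 hf)

/-- A linear map with finite-dimensional kernel and cokernel is asymptotically invertible. -/
theorem HasIndex.isIso {f : N →ₗ[K] M} {d : ℤ} (hf : HasIndex f d) : (asymp f).IsIso := by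
  have h1 := hf.finite_ker
  have h2 := hf.finite_coker
  obtain ⟨s, hs⟩ := f.rangeRestrict.exists_rightInverse_of_surjective f.range_rangeRestrict
  obtain ⟨r, hr⟩ := (LinearMap.range f).subtype.exists_leftInverse_of_injective
    (Submodule.ker_subtype _)
  -- `g` is a generalized inverse: `f g f = f`
  let g : M →ₗ[K] N := s ∘ₗ r
  have hg : ∀ x, f (g (f x)) = f x := by
    intro x
    have e1 : r (f x) = f.rangeRestrict x := LinearMap.congr_fun hr (f.rangeRestrict x)
    have e2 := LinearMap.congr_fun hs (f.rangeRestrict x)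
    change f (s (r (f x))) = f x
    rw [e1]
    exact congrArg Subtype.val e2
  refine ⟨asymp g, ?_, ?_⟩
  · rw [asymp_comp, asymp_eq_iff]
    have hle : LinearMap.range (g ∘ₗ f - LinearMap.id) ≤ LinearMap.ker f := by
      rintro _ ⟨x, rfl⟩
      simp [hg]
    exact Submodule.finiteDimensional_of_le hle
  · rw [asymp_comp, asymp_eq_iff]
    have hle : LinearMap.range f ≤ LinearMap.ker (f ∘ₗ g - LinearMap.id) := by
      rintro _ ⟨x, rfl⟩
      simp [hg]
    have h3 : LinearMap.range (f ∘ₗ g - LinearMap.id) =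
        LinearMap.range ((LinearMap.range f).liftQ (f ∘ₗ g - LinearMap.id) hle) :=
      (Submodule.range_liftQ _ _ _).symm
    rw [h3]
    infer_instance

/-- The degree of the relative determinant line is minus the index. -/
theorem relDet_degree {f : N →ₗ[K] M} {d : ℤ} (hf : HasIndex f d) (h : (asymp f).IsIso) :
    (relDet (asymp f) h).degree = -d := by
  unfold relDet
  generalize (DetDatum.nonempty h).some = D
  have hD : HasIndex D.f d := hf.congr_asymp D.asymp_f.symm
  have hP := D.finite_P
  have hQ := D.finite_Q
  have hk : FiniteDimensional K (LinearMap.ker D.P.mkQ) := by rwa [Submodule.ker_mkQ]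
  have hkQ : LinearMap.ker (D.P.mkQ ∘ₗ D.f) = D.P.comap D.f := by
    rw [LinearMap.ker_comp, Submodule.ker_mkQ]
  have hk' : FiniteDimensional K (LinearMap.ker (D.P.mkQ ∘ₗ D.f)) := by rwa [hkQ]
  have hsurj : Function.Surjective (D.P.mkQ ∘ₗ D.f) := by
    rw [← LinearMap.range_eq_top, LinearMap.range_comp, Submodule.map_mkQ_eq_top]
    exact D.sup_range
  have h1 := (hasIndex_surjective_comp D.f D.P.mkQ_surjective _).1 (hasIndex_of_surjective hsurj)
  have h2 := hD.unique h1
  rw [hkQ, Submodule.ker_mkQ] at h2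
  change (Module.finrank K D.P : ℤ) + -(Module.finrank K (D.P.comap D.f) : ℤ) = -d
  rw [h2]
  ring

theorem ker_factor {L L' : Submodule K M} (h : L ≤ L') :
    LinearMap.ker (Submodule.factor h) = L'.map L.mkQ := by
  rw [Submodule.factor, Submodule.mapQ, Submodule.ker_liftQ, LinearMap.comp_id, Submodule.ker_mkQ]

theorem mapQ_bijective {L : Submodule K N} {L' : Submodule K M} {g : N →ₗ[K] M} (h : L ≤ L'.comap g)
    (hinj : ∀ x, g x ∈ L' → x ∈ L) (hsurj : ∀ y, ∃ x, g x - y ∈ L') :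
    Function.Bijective (L.mapQ L' g h) := by
  constructor
  · rw [← LinearMap.ker_eq_bot, eq_bot_iff]
    intro x hx
    obtain ⟨x, rfl⟩ := L.mkQ_surjective x
    rw [LinearMap.mem_ker, Submodule.mkQ_apply, Submodule.mapQ_apply,
      Submodule.Quotient.mk_eq_zero] at hx
    rw [Submodule.mem_bot, Submodule.mkQ_apply, Submodule.Quotient.mk_eq_zero]
    exact hinj x hx
  · intro y
    obtain ⟨y, rfl⟩ := L'.mkQ_surjective y
    obtain ⟨x, hx⟩ := hsurj y
    exact ⟨L.mkQ x, (Submodule.Quotient.eq L').2 hx⟩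

end FredholmIndex

/-! ### The filtration of Laurent series by order -/

section Filtration

variable (K : Type u) [Field K]

-- Instance search finds `HahnSeries.instModule` for the action of `K` on `K((t))`, which is not
-- definitionally the action underlying Mathlib's `Algebra K K((t))`; the compatibilities of the
-- former with multiplication are supplied here.
instance : IsScalarTower K K⸨X⸩ K⸨X⸩ where
  smul_assoc c f g := by
    rw [smul_eq_mul, smul_eq_mul, ← HahnSeries.C_mul_eq_smul, ← HahnSeries.C_mul_eq_smul, mul_assoc]

instance : SMulCommClass K K⸨X⸩ K⸨X⸩ where
  smul_comm c f g := by
    rw [smul_eq_mul, smul_eq_mul, ← HahnSeries.C_mul_eq_smul, ← HahnSeries.C_mul_eq_smul,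
      mul_left_comm]

/-- The subspace `t^m K[[t]]` of `K((t))`. -/
def fil (m : ℤ) : Submodule K K⸨X⸩ where
  carrier := {f | ∀ k < m, f.coeff k = 0}
  zero_mem' := by simp
  add_mem' := by
    intro f g hf hg k hk
    rw [HahnSeries.coeff_add, hf k hk, hg k hk, add_zero]
  smul_mem' := by
    intro c f hf k hk
    rw [HahnSeries.coeff_smul, hf k hk, smul_zero]

variable {K}

theorem mem_fil {m : ℤ} {f : K⸨X⸩} : f ∈ fil K m ↔ ∀ k < m, f.coeff k = 0 := Iff.rfl

theorem mem_fil_iff_orderTop {m : ℤ} {f : K⸨X⸩} :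
    f ∈ fil K m ↔ (m : WithTop ℤ) ≤ f.orderTop := by
  rw [HahnSeries.le_orderTop_iff_forall]
  simp [mem_fil]

theorem fil_anti : Antitone (fil K) := fun _ _ h _ hf k hk => hf k (hk.trans_le h)

theorem mem_fil_order (f : K⸨X⸩) : f ∈ fil K f.order :=
  fun _ hk => HahnSeries.coeff_eq_zero_of_lt_order hk

theorem single_mem_fil (m : ℤ) (c : K) : HahnSeries.single m c ∈ fil K m :=
  fun _ hk => HahnSeries.coeff_single_of_ne hk.ne

theorem mul_mem_fil {a b : ℤ} {f g : K⸨X⸩} (hf : f ∈ fil K a) (hg : g ∈ fil K b) :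
    f * g ∈ fil K (a + b) := by
  rw [mem_fil_iff_orderTop] at *
  rw [WithTop.coe_add]
  exact (add_le_add hf hg).trans HahnSeries.orderTop_add_le_mul

theorem mem_fil_succ {m : ℤ} {f : K⸨X⸩} : f ∈ fil K (m + 1) ↔ f ∈ fil K m ∧ f.coeff m = 0 := by
  constructor
  · exact fun h => ⟨fil_anti (by lia) h, h m (by lia)⟩
  · rintro ⟨h1, h2⟩ k hk
    obtain h | rfl := (Int.lt_add_one_iff.1 hk).lt_or_eq
    exacts [h1 k h, h2]

theorem coeff_mul_of_mem_fil {a b : ℤ} {f g : K⸨X⸩} (hf : f ∈ fil K a) (hg : g ∈ fil K b) :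
    (f * g).coeff (a + b) = f.coeff a * g.coeff b := by
  have h : f - HahnSeries.single a (f.coeff a) ∈ fil K (a + 1) :=
    mem_fil_succ.2 ⟨sub_mem hf (single_mem_fil _ _), by simp⟩
  have h2 := mul_mem_fil h hg (a + b) (by lia)
  rw [sub_mul, HahnSeries.coeff_sub, sub_eq_zero] at h2
  rw [h2, add_comm a b, HahnSeries.coeff_single_mul_add]

theorem exists_coe_of_mem_fil_zero {f : K⸨X⸩} (hf : f ∈ fil K 0) :
    ∃ a : K⟦X⟧, (a : K⸨X⸩) = f := by
  refine ⟨PowerSeries.mk fun n => f.coeff n, ?_⟩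
  ext k
  rw [PowerSeries.coeff_coe]
  split_ifs with h
  · exact (hf k h).symm
  · rw [PowerSeries.coeff_mk, Int.natCast_natAbs, abs_of_nonneg (not_lt.1 h)]

theorem coe_mem_fil_zero (a : K⟦X⟧) : (a : K⸨X⸩) ∈ fil K 0 := by
  intro k hk
  rw [PowerSeries.coeff_coe, if_pos hk]

variable (K) in
/-- The derivation `t d/dt` of `K((t))`. -/
def theta : K⸨X⸩ →ₗ[K] K⸨X⸩ :=
  LinearMap.mulLeft K (HahnSeries.single 1 1) ∘ₗ LaurentSeries.derivative K

theorem coeff_theta (f : K⸨X⸩) (k : ℤ) : (theta K f).coeff k = k * f.coeff k := by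
  simp [theta, HahnSeries.coeff_single_mul, LaurentSeries.derivative_apply]

theorem theta_mem_fil {m : ℤ} {f : K⸨X⸩} (hf : f ∈ fil K m) : theta K f ∈ fil K m := by
  intro k hk
  rw [coeff_theta, hf k hk, mul_zero]

theorem coeff_neg_theta_pow (i : ℕ) (f : K⸨X⸩) (k : ℤ) :
    (((-theta K) ^ i) f).coeff k = (-(k : K)) ^ i * f.coeff k := by
  induction i with
  | zero => simp
  | succ i ih =>
    rw [pow_succ', Module.End.mul_apply, LinearMap.neg_apply, HahnSeries.coeff_neg, coeff_theta, ih]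
    ring

theorem neg_theta_pow_mem_fil (i : ℕ) {m : ℤ} {f : K⸨X⸩} (hf : f ∈ fil K m) :
    ((-theta K) ^ i) f ∈ fil K m := by
  intro k hk
  rw [coeff_neg_theta_pow, hf k hk, mul_zero]

end Filtration

/-! ### Coordinate lattices and c-lattices -/

section Box

variable {K : Type u} [Field K] {V : Type v} [AddCommGroup V] [Module K⸨X⸩ V]
  [Module K V] [IsScalarTower K K⸨X⸩ V] {ι : Type}

/-- The coordinate lattice `⨁ t^{c i} K[[t]] b i` of a basis `b`. -/
def box (b : Module.Basis ι K⸨X⸩ V) (c : ι → ℤ) : Submodule K V :=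
  ⨅ i, (fil K (c i)).comap ((b.coord i).restrictScalars K)

variable (b : Module.Basis ι K⸨X⸩ V)

theorem mem_box {b : Module.Basis ι K⸨X⸩ V} {c : ι → ℤ} {x : V} :
    x ∈ box b c ↔ ∀ i, b.repr x i ∈ fil K (c i) := by
  simp [box]

theorem box_anti : Antitone (box b) := fun _ _ h _ hx =>
  mem_box.2 fun i => fil_anti (h i) (mem_box.1 hx i)

theorem smul_mem_box {b : Module.Basis ι K⸨X⸩ V} {m : ℤ} {f : K⸨X⸩} (hf : f ∈ fil K m)
    {c : ι → ℤ} {x : V} (hx : x ∈ box b c) : f • x ∈ box b (fun i => m + c i) := by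
  rw [mem_box] at *
  intro i
  rw [map_smul, Finsupp.smul_apply, smul_eq_mul]
  exact mul_mem_fil hf (hx i)

theorem smul_basis_mem_box [DecidableEq ι] {m : ℤ} {f : K⸨X⸩} (hf : f ∈ fil K m) (i : ι) {c : ι → ℤ}
    (hc : c i ≤ m) : f • b i ∈ box b c := by
  rw [mem_box]
  intro j
  rw [map_smul, Finsupp.smul_apply, smul_eq_mul, Module.Basis.repr_self, Finsupp.single_apply]
  split_ifs with h
  · subst h
    rw [mul_one]
    exact fil_anti hc hf
  · rw [mul_zero]
    exact zero_mem _

theorem isOpenSubspace_box (c : ι → ℤ) : IsOpenSubspace K (box b c) := by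
  classical
  refine ⟨box b c, ?_, ?_, le_rfl⟩
  · intro a x hx
    simpa using smul_mem_box (coe_mem_fil_zero a) hx
  · rw [eq_top_iff, ← b.span_eq, Submodule.span_le]
    rintro _ ⟨i, rfl⟩
    have h1 : (HahnSeries.single (c i) (1 : K)) • b i ∈ box b c :=
      smul_basis_mem_box b (single_mem_fil _ _) i le_rfl
    have h2 : b i = HahnSeries.single (-c i) (1 : K) • HahnSeries.single (c i) (1 : K) • b i := by
      rw [smul_smul, HahnSeries.single_mul_single, neg_add_cancel, mul_one]
      simp
    rw [h2]
    exact Submodule.smul_mem _ _ (Submodule.subset_span h1)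

variable [Fintype ι]

theorem exists_mem_box (x : V) : ∃ m : ℤ, x ∈ box b fun _ => m := by
  obtain ⟨m, hm⟩ := (Set.finite_range fun i => (b.repr x i).order).bddBelow
  exact ⟨m, mem_box.2 fun i => fil_anti (hm ⟨i, rfl⟩) (mem_fil_order _)⟩

/-- An open subspace contains a coordinate lattice. -/
theorem IsOpenSubspace.exists_box_le {U : Submodule K V} (hU : IsOpenSubspace K U) :
    ∃ m : ℤ, ∀ m' ≥ m, (box b fun _ => m') ≤ U := by
  obtain ⟨S, hS, hspan, hSU⟩ := hU
  -- high multiples of any vector lie in the `K[[t]]`-submodule `S`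
  have key : ∀ x : V, ∃ m : ℤ, ∀ f ∈ fil K m, f • x ∈ S := by
    intro x
    have hx : x ∈ Submodule.span K⸨X⸩ (S : Set V) := by rw [hspan]; trivial
    induction hx using Submodule.span_induction with
    | mem x hx =>
      refine ⟨0, fun f hf => ?_⟩
      obtain ⟨a, rfl⟩ := exists_coe_of_mem_fil_zero hf
      exact hS a x hx
    | zero => exact ⟨0, fun f _ => by rw [smul_zero]; exact zero_mem _⟩
    | add x y _ _ hx hy =>
      obtain ⟨m, hm⟩ := hx
      obtain ⟨m', hm'⟩ := hy
      refine ⟨max m m', fun f hf => ?_⟩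
      rw [smul_add]
      exact add_mem (hm f (fil_anti (le_max_left _ _) hf)) (hm' f (fil_anti (le_max_right _ _) hf))
    | smul a x _ hx =>
      obtain ⟨m, hm⟩ := hx
      refine ⟨m - a.order, fun f hf => ?_⟩
      rw [smul_smul]
      exact hm _ (by simpa using mul_mem_fil hf (mem_fil_order a))
  choose m hm using fun i => key (b i)
  obtain ⟨M, hM⟩ := (Set.finite_range m).bddAbove
  refine ⟨M, fun m' hm' x hx => hSU ?_⟩
  rw [← b.sum_repr x]
  exact sum_mem fun i _ => hm i _ (fil_anti ((hM ⟨i, rfl⟩).trans hm') (mem_box.1 hx i))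

/-- A bounded subspace is contained in a coordinate lattice. -/
theorem IsBoundedSubspace.exists_le_box {L : Submodule K V} (hL : IsBoundedSubspace K L) :
    ∃ m : ℤ, ∀ m' ≤ m, L ≤ box b fun _ => m' := by
  have hfin := Module.Finite.iff_fg.1 (hL _ (isOpenSubspace_box b fun _ => 0))
  have key : ∀ N : Submodule K (V ⧸ box b fun _ => 0), N.FG →
      ∃ m : ℤ, N ≤ (box b fun _ => m).map (box b fun _ => 0).mkQ := by
    intro N hN
    induction N, hN using Submodule.fg_induction with
    | singleton x =>
      obtain ⟨y, rfl⟩ := Submodule.mkQ_surjective _ x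
      obtain ⟨m, hm⟩ := exists_mem_box b y
      exact ⟨m, by
        rw [Submodule.span_singleton_le_iff_mem]
        exact Submodule.mem_map_of_mem hm⟩
    | sup N₁ N₂ _ _ h₁ h₂ =>
      obtain ⟨m₁, hm₁⟩ := h₁
      obtain ⟨m₂, hm₂⟩ := h₂
      exact ⟨min m₁ m₂, sup_le
        (hm₁.trans (Submodule.map_mono (box_anti b fun _ => min_le_left _ _)))
        (hm₂.trans (Submodule.map_mono (box_anti b fun _ => min_le_right _ _)))⟩
  obtain ⟨m, hm⟩ := key _ hfin
  refine ⟨min 0 m, fun m' hm' => ?_⟩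
  rw [Submodule.map_le_iff_le_comap, Submodule.comap_map_mkQ] at hm
  exact hm.trans (sup_le (box_anti b fun _ => hm'.trans (min_le_left _ _))
    (box_anti b fun _ => hm'.trans (min_le_right _ _)))

variable (K) in
/-- The coefficients of `x` in degrees `c i, …, d i - 1` of its coordinates. -/
def boxCoeff (c d : ι → ℤ) : V →ₗ[K] (Σ i, Fin (d i - c i).toNat) → K where
  toFun x s := (b.repr x s.1).coeff (c s.1 + s.2)
  map_add' x y := by ext s; simp
  map_smul' a x := by
    ext s
    have h := ((b.coord s.1).restrictScalars K).map_smul a x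
    simp only [LinearMap.coe_restrictScalars, Module.Basis.coord_apply] at h
    simp [h]

/-- The relative dimension of two nested coordinate lattices. -/
theorem finrank_ker_factor_box {c d : ι → ℤ} (h : c ≤ d) :
    FiniteDimensional K (LinearMap.ker (Submodule.factor (box_anti b h))) ∧
    (Module.finrank K (LinearMap.ker (Submodule.factor (box_anti b h))) : ℤ) =
      ∑ i, (d i - c i) := by
  classical
  let φ := (boxCoeff K b c d).domRestrict (box b c)
  have hφ : Function.Surjective φ := by
    intro g
    let f : ι → K⸨X⸩ := fun i =>
      ∑ j : Fin (d i - c i).toNat, HahnSeries.single (c i + j) (g ⟨i, j⟩)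
    have hf : ∀ i, f i ∈ fil K (c i) := fun i =>
      sum_mem fun j _ => fil_anti (by lia) (single_mem_fil _ _)
    refine ⟨⟨∑ i, f i • b i, sum_mem fun i _ => smul_basis_mem_box b (hf i) i le_rfl⟩, ?_⟩
    ext ⟨i, j⟩
    change (b.repr (∑ i, f i • b i) i).coeff (c i + j) = _
    rw [Module.Basis.repr_sum_self, HahnSeries.coeff_sum, Finset.sum_eq_single j]
    · simp
    · intro j' _ hj
      refine HahnSeries.coeff_single_of_ne ?_
      intro h
      exact hj (Fin.ext (by lia))
    · simp
  have hkerφ : LinearMap.ker φ = LinearMap.ker ((box b d).mkQ.domRestrict (box b c)) := by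
    rw [LinearMap.ker_domRestrict (box b c) (box b d).mkQ, Submodule.ker_mkQ]
    ext ⟨x, hx⟩
    rw [mem_box] at hx
    rw [LinearMap.mem_ker, Submodule.mem_comap, Submodule.subtype_apply, mem_box]
    constructor
    · intro h0 i k hk
      by_cases hk' : k < c i
      · exact hx i k hk'
      · have := congrFun h0 ⟨i, ⟨(k - c i).toNat, by lia⟩⟩
        change (b.repr x i).coeff (c i + ((k - c i).toNat : ℕ)) = 0 at this
        rwa [show c i + ((k - c i).toNat : ℕ) = k by lia] at this
    · intro h0
      ext ⟨i, j⟩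
      exact h0 i _ (by have := j.2; lia)
  have hker : LinearMap.ker (Submodule.factor (box_anti b h)) =
      LinearMap.range ((box b d).mkQ.domRestrict (box b c)) := by
    rw [LinearMap.range_domRestrict, ker_factor]
  let e := (φ.quotKerEquivOfSurjective hφ).symm.trans
    ((Submodule.quotEquivOfEq _ _ hkerφ).trans
      ((box b d).mkQ.domRestrict (box b c)).quotKerEquivRange)
  rw [hker]
  refine ⟨Module.Finite.equiv e, ?_⟩
  rw [← e.finrank_eq, Module.finrank_fintype_fun_eq_card]
  simp only [Fintype.card_sigma, Fintype.card_fin, Nat.cast_sum]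
  exact Finset.sum_congr rfl fun i _ => Int.toNat_of_nonneg (sub_nonneg.2 (h i))

end Box

section BoxIndex

variable {K : Type u} [Field K] {V : Type v} [AddCommGroup V] [Module K⸨X⸩ V]
  [Module K V] [IsScalarTower K K⸨X⸩ V] {ι : Type} [Fintype ι]
  (b : Module.Basis ι K⸨X⸩ V)

theorem hasIndex_factor_box {c d : ι → ℤ} (h : c ≤ d) :
    HasIndex (Submodule.factor (box_anti b h)) (∑ i, (d i - c i)) := by
  have := (finrank_ker_factor_box b h).1
  rw [← (finrank_ker_factor_box b h).2]
  exact hasIndex_of_surjective (Submodule.factor_surjective _)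

theorem isBoundedSubspace_box (c : ι → ℤ) : IsBoundedSubspace K (box b c) := by
  intro U hU
  obtain ⟨m, hm⟩ := hU.exists_box_le b
  obtain ⟨m', hm'⟩ := (Set.finite_range c).bddAbove
  have hcd : c ≤ fun _ => max m m' := fun i => (hm' ⟨i, rfl⟩).trans (le_max_right _ _)
  have h1 : FiniteDimensional K
      ((box b c).map (box b fun _ => max m m').mkQ) := by
    have := (finrank_ker_factor_box b hcd).1
    rwa [ker_factor] at this
  have h2 : U.mkQ = Submodule.factor (hm _ (le_max_left m m')) ∘ₗ
      (box b fun _ => max m m').mkQ := (Submodule.factor_comp_mk _).symm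
  rw [h2, Submodule.map_comp]
  infer_instance

theorem isCLattice_box (c : ι → ℤ) : IsCLattice K (box b c) :=
  ⟨isOpenSubspace_box b c, isBoundedSubspace_box b c⟩

/-- A `K`-linear operator with `δ (f x) = t f' x + f δ x`, such as the covariant derivative
along `t d/dt`. -/
def IsThetaLinear (δ : V →ₗ[K] V) : Prop :=
  ∀ (f : K⸨X⸩) (x : V), δ (f • x) = theta K f • x + f • δ x

theorem IsThetaLinear.exists_map_box_le {δ : V →ₗ[K] V} (hδ : IsThetaLinear δ) (m : ℤ) :
    ∃ m' : ℤ, ∀ x ∈ box b (fun _ => m), δ x ∈ box b fun _ => m' := by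
  classical
  choose k hk using fun i => exists_mem_box b (δ (b i))
  obtain ⟨k', hk'⟩ := (Set.finite_range k).bddBelow
  refine ⟨min m (m + k'), fun x hx => ?_⟩
  rw [mem_box] at hx
  rw [← b.sum_repr x, map_sum]
  refine sum_mem fun i _ => ?_
  rw [hδ]
  refine add_mem (smul_basis_mem_box b (theta_mem_fil (hx i)) i (min_le_left _ _)) ?_
  exact box_anti b (fun j => (min_le_right _ _).trans (by linarith [hk' ⟨i, rfl⟩]))
    (smul_mem_box (hx i) (hk i))

end BoxIndex

/-! ### Covariant derivatives along vector fields -/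

section Covariant

variable {K : Type u} [Field K] {V : Type v} [AddCommGroup V] [Module K⸨X⸩ V]
  [Module K V] [IsScalarTower K K⸨X⸩ V] (nabla : Connection K V)

theorem Connection.along_smul (g : K⸨X⸩) (τ : VectorField K) (x : V) :
    nabla.along (g • τ) x = g • nabla.along τ x := by
  simp only [Connection.along, LinearMap.comp_apply, LinearMap.coe_restrictScalars,
    LinearMap.rTensor_smul, LinearMap.smul_apply]
  exact map_smul _ _ _

theorem Connection.isThetaLinear_delta : IsThetaLinear nabla.delta := by
  intro f x
  have h : tau (dlogT K) (dForm K f) = theta K f := by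
    simp [tau, dlogT, dForm, theta]
  change (TensorProduct.lid K⸨X⸩ V) (LinearMap.rTensor V (tau (dlogT K))
    (nabla.toLinearMap (f • x))) = _
  rw [nabla.leibniz, map_add, map_add, LinearMap.rTensor_tmul, TensorProduct.lid_tmul, h,
    map_smul, map_smul]
  rfl

theorem tau_eq_smul (ν : Form K) :
    tau ν = ((coeffDt K ν)⁻¹ * HahnSeries.single (-1) 1) • tau (dlogT K) := by
  refine LinearMap.ext fun x => ?_
  have h : (HahnSeries.single (-1) 1 : K⸨X⸩) ≠ 0 := by simp
  simp only [tau, dlogT, LinearMap.smul_apply, smul_eq_mul, LinearEquiv.coe_coe,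
    LinearEquiv.apply_symm_apply]
  rw [mul_assoc, mul_inv_cancel_left₀ h]

theorem Connection.along_tau (ν : Form K) (x : V) :
    nabla.along (tau ν) x =
      ((coeffDt K ν)⁻¹ * HahnSeries.single (-1) 1) • nabla.delta x := by
  rw [tau_eq_smul, nabla.along_smul]
  rfl

end Covariant

/-! ### Existence of cyclic vectors -/

section Cyclic

open Polynomial

/-- If `x` is linearly independent, then `x + μ y` is linearly dependent for only finitely many
values of `μ`. -/
theorem exists_linearIndependent_add_smul {F W : Type*} [Field F] [AddCommGroup W] [Module F W]
    {n : ℕ} {x : Fin n → W} (hx : LinearIndependent F x) (y : Fin n → W) {s : Set F}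
    (hs : s.Infinite) : ∃ μ ∈ s, LinearIndependent F (fun i => x i + μ • y i) := by
  classical
  -- `q` is a projection onto `F ^ n` that sends `x` to the standard basis
  obtain ⟨q, hq⟩ := (Fintype.linearCombination F x).exists_leftInverse_of_injective
    (LinearMap.ker_eq_bot.2 hx.fintypeLinearCombination_injective)
  have hqx : ∀ i, q (x i) = Pi.single i 1 := fun i => by
    have := LinearMap.congr_fun hq (Pi.single i 1)
    simpa using this
  let Y : Matrix (Fin n) (Fin n) F := Matrix.of fun i => q (y i)
  let p : F[X] := (1 + (X : F[X]) • Y.map C).det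
  have hp : ∀ μ, p.eval μ = (1 + μ • Y).det := by
    intro μ
    simp only [p]
    rw [← Polynomial.coe_evalRingHom, RingHom.map_det]
    congr 1
    ext i j
    by_cases h : i = j <;> simp [h] <;> exact mul_comm _ _
  have hp0 : p ≠ 0 := by
    intro h
    have := hp 0
    simp [h] at this
  obtain ⟨μ, hμ, hroot⟩ := hs.exists_notMem_finset p.roots.toFinset
  refine ⟨μ, hμ, LinearIndependent.of_comp q ?_⟩
  have hdet : (1 + μ • Y).det ≠ 0 := by
    rw [← hp]
    intro h
    exact hroot (by simp [hp0, h])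
  have := Matrix.linearIndependent_rows_of_isUnit
    ((Matrix.isUnit_iff_isUnit_det _).2 (isUnit_iff_ne_zero.2 hdet))
  have heq : (q ∘ fun i => x i + μ • y i) = (1 + μ • Y).row := by
    ext i j
    simp [hqx, Y, Matrix.one_apply, Pi.single_apply, eq_comm]
  rw [heq]
  exact this

variable {K : Type u} [Field K] {V : Type v} [AddCommGroup V] [Module K⸨X⸩ V]
  [Module K V] {δ : V →ₗ[K] V}

theorem IsThetaLinear.pow_single_smul (hδ : IsThetaLinear δ) (k : ℕ) (c : K) (i : ℕ) (f : V) :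
    (δ ^ i) ((HahnSeries.single (k : ℤ) c : K⸨X⸩) • f) =
      (HahnSeries.single (k : ℤ) c : K⸨X⸩) • ((δ + k • 1) ^ i) f := by
  have h : theta K (HahnSeries.single (k : ℤ) c) = k • (HahnSeries.single (k : ℤ) c : K⸨X⸩) := by
    ext j
    rw [coeff_theta, HahnSeries.coeff_nsmul, Pi.smul_apply]
    by_cases hj : j = k
    · subst hj; simp
    · simp [HahnSeries.coeff_single_of_ne hj]
  induction i generalizing f with
  | zero => rfl
  | succ i ih =>
    rw [pow_succ, Module.End.mul_apply, hδ, h, map_add, smul_assoc, map_nsmul, ih, ih, pow_succ,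
      Module.End.mul_apply, ← smul_comm, ← smul_add, ← map_nsmul, ← map_add, add_comm (k • f)]
    rfl

/-- For a linear functional `φ`, the quantity `φ ((δ + k) ^ i f)` is a polynomial in `k` of degree
at most `i`, and its coefficient of degree `i` is `φ f`. -/
theorem exists_polynomial_eval_add_pow (δ : V →ₗ[K] V) (φ : V →ₗ[K⸨X⸩] K⸨X⸩) (i : ℕ) (f : V) :
    ∃ p : K⸨X⸩[X], p.natDegree ≤ i ∧ p.coeff i = φ f ∧
      ∀ k : ℕ, p.eval (k : K⸨X⸩) = φ (((δ + k • 1) ^ i) f) := by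
  induction i generalizing f with
  | zero => exact ⟨C (φ f), by simp, by simp, by simp⟩
  | succ i ih =>
    obtain ⟨p, hp1, hp2, hp3⟩ := ih f
    obtain ⟨q, hq1, hq2, hq3⟩ := ih (δ f)
    refine ⟨q + p * X, ?_, ?_, fun k => ?_⟩
    · refine (natDegree_add_le _ _).trans (max_le (by lia) ?_)
      exact natDegree_mul_le.trans (add_le_add hp1 natDegree_X_le)
    · rw [coeff_add, coeff_mul_X, hp2, coeff_eq_zero_of_natDegree_lt (by lia), zero_add]
    · rw [eval_add, eval_mul, eval_X, hp3, hq3, pow_succ, Module.End.mul_apply,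
        LinearMap.add_apply, map_add, map_add, LinearMap.smul_apply, Module.End.one_apply,
        map_nsmul, map_nsmul, ← nsmul_eq_mul']

/-- If `e, δ e, …, δ ^ (m - 1) e` are independent and do not span `V`, then some
`z = e + c t ^ k f` has `z, δ z, …, δ ^ m z` independent. -/
theorem IsThetaLinear.exists_linearIndependent_succ [CharZero K] (hδ : IsThetaLinear δ) {m : ℕ}
    (hm : m < Module.finrank K⸨X⸩ V) {e : V}
    (he : LinearIndependent K⸨X⸩ fun i : Fin m => (δ ^ (i : ℕ)) e) :
    ∃ z : V, LinearIndependent K⸨X⸩ fun i : Fin (m + 1) => (δ ^ (i : ℕ)) z := by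
  set W := Submodule.span K⸨X⸩ (Set.range fun i : Fin m => (δ ^ (i : ℕ)) e) with hW
  by_cases hmem : (δ ^ m) e ∈ W
  swap
  · exact ⟨e, linearIndependent_finSucc'.2 ⟨he, hmem⟩⟩
  obtain ⟨c, hc⟩ := (Submodule.mem_span_range_iff_exists_fun _).1 hmem
  have : CharZero K⸨X⸩ :=
    charZero_of_injective_ringHom (f := (HahnSeries.C : K →+* K⸨X⸩)) HahnSeries.C_injective
  have hWtop : W ≠ ⊤ := by
    intro h
    have h1 := finrank_range_le_card (R := K⸨X⸩) (fun i : Fin m => (δ ^ (i : ℕ)) e)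
    rw [Set.finrank, ← hW, h, finrank_top, Fintype.card_fin] at h1
    lia
  obtain ⟨f, hf⟩ : ∃ f, f ∉ W := by
    by_contra! h
    exact hWtop (eq_top_iff.2 fun x _ => h x)
  obtain ⟨φ, hφf, hφ⟩ := Submodule.exists_le_ker_of_notMem hf
  choose p hp1 hp2 hp3 using fun i => exists_polynomial_eval_add_pow δ φ i f
  -- `P = p m - ∑ c i p i` computes `φ` of `(D + k) f`, where `D = δ ^ m - ∑ c i δ ^ i` kills `e`
  let P : K⸨X⸩[X] := p m - ∑ i : Fin m, C (c i) * p i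
  have hP : P ≠ 0 := by
    intro h
    have h1 : P.coeff m = φ f := by
      rw [coeff_sub, hp2, finsetSum_coeff, Finset.sum_eq_zero, sub_zero]
      intro i _
      rw [coeff_C_mul, coeff_eq_zero_of_natDegree_lt ((hp1 i).trans_lt i.2), mul_zero]
    rw [h, coeff_zero] at h1
    exact hφf h1.symm
  obtain ⟨k, hk⟩ : ∃ k : ℕ, P.eval (k : K⸨X⸩) ≠ 0 := by
    by_contra! h
    exact hP (Polynomial.eq_zero_of_infinite_isRoot P
      ((Set.infinite_range_of_injective Nat.cast_injective).mono
        (by rintro _ ⟨k, rfl⟩; exact h k)))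
  let g : V := ((δ + k • 1) ^ m) f - ∑ i : Fin m, c i • ((δ + k • 1) ^ (i : ℕ)) f
  have hg : g ∉ W := by
    intro h
    apply hk
    have h1 : φ g = 0 := hφ h
    simp only [g, map_sub, map_sum, map_smul, smul_eq_mul] at h1
    simp only [P, eval_sub, eval_finsetSum, eval_mul, eval_C, hp3]
    exact h1
  have hx : LinearIndependent K⸨X⸩
      (Fin.snoc (fun i : Fin m => (δ ^ (i : ℕ)) e) g : Fin (m + 1) → V) := by
    rw [linearIndependent_finSucc']
    simp only [Fin.init_snoc, Fin.snoc_last]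
    exact ⟨he, hg⟩
  have hs : ((fun c : K => (HahnSeries.single (k : ℤ) c : K⸨X⸩)) '' {0}ᶜ).Infinite :=
    (Set.finite_singleton (0 : K)).infinite_compl.image
      (HahnSeries.single_injective _).injOn
  obtain ⟨_, ⟨a, ha, rfl⟩, hli⟩ := exists_linearIndependent_add_smul hx
    (Fin.snoc (fun i : Fin m => ((δ + k • 1) ^ (i : ℕ)) f) 0 : Fin (m + 1) → V) hs
  set μ : K⸨X⸩ := HahnSeries.single (k : ℤ) a with hμ
  have hμ0 : μ ≠ 0 := by simpa [hμ] using ha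
  have hz : ∀ i : ℕ, (δ ^ i) (e + μ • f) = (δ ^ i) e + μ • ((δ + k • 1) ^ i) f := by
    intro i
    rw [map_add, hμ, hδ.pow_single_smul]
  have hli' : LinearIndependent K⸨X⸩
      (Fin.snoc (fun i : Fin m => (δ ^ (i : ℕ)) (e + μ • f)) g : Fin (m + 1) → V) := by
    have heq : (Fin.snoc (fun i : Fin m => (δ ^ (i : ℕ)) (e + μ • f)) g : Fin (m + 1) → V) =
        fun i => (Fin.snoc (fun i : Fin m => (δ ^ (i : ℕ)) e) g : Fin (m + 1) → V) i +
          μ • (Fin.snoc (fun i : Fin m => ((δ + k • 1) ^ (i : ℕ)) f) 0 : Fin (m + 1) → V) i := by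
      ext i
      refine Fin.lastCases ?_ (fun i => ?_) i <;> simp [hz]
    rw [heq]
    exact hli
  rw [linearIndependent_finSucc'] at hli'
  simp only [Fin.init_snoc, Fin.snoc_last] at hli'
  refine ⟨e + μ • f, linearIndependent_finSucc'.2 ⟨hli'.1, fun h => hli'.2 ?_⟩⟩
  set Z := Submodule.span K⸨X⸩ (Set.range fun i : Fin m => (δ ^ (i : ℕ)) (e + μ • f)) with hZ
  have h1 : (δ ^ m) (e + μ • f) ∈ Z := h
  have h2 : μ • g = (δ ^ m) (e + μ • f) - ∑ i : Fin m, c i • (δ ^ (i : ℕ)) (e + μ • f) := by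
    simp only [hz, smul_add, Finset.sum_add_distrib, hc, g, smul_sub, Finset.smul_sum,
      smul_comm μ]
    abel
  have h3 : μ • g ∈ Z := by
    rw [h2]
    exact sub_mem h1 (sum_mem fun i _ => Submodule.smul_mem _ _ (Submodule.subset_span ⟨i, rfl⟩))
  exact (Submodule.smul_mem_iff _ hμ0).1 h3

/-- A cyclic vector, in terms of independence of its iterated derivatives. -/
theorem IsThetaLinear.exists_linearIndependent_pow [CharZero K] (hδ : IsThetaLinear δ) :
    ∃ e : V, LinearIndependent K⸨X⸩
      fun i : Fin (Module.finrank K⸨X⸩ V) => (δ ^ (i : ℕ)) e := by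
  have key : ∀ m ≤ Module.finrank K⸨X⸩ V,
      ∃ e : V, LinearIndependent K⸨X⸩ fun i : Fin m => (δ ^ (i : ℕ)) e := by
    intro m
    induction m with
    | zero => exact fun _ => ⟨0, linearIndependent_empty_type⟩
    | succ m ih =>
      intro hm
      obtain ⟨e, he⟩ := ih (by lia)
      exact hδ.exists_linearIndependent_succ hm he
  exact key _ le_rfl

variable [IsScalarTower K K⸨X⸩ V] [FiniteDimensional K⸨X⸩ V]

theorem Connection.exists_isCyclicEquation [CharZero K] (nabla : Connection K V) :
    ∃ e a, nabla.IsCyclicEquation e a := by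
  obtain ⟨e, he⟩ := nabla.isThetaLinear_delta.exists_linearIndependent_pow
  have htop : Submodule.span K⸨X⸩
      (Set.range fun i : Fin (Module.finrank K⸨X⸩ V) => (nabla.delta ^ (i : ℕ)) e) = ⊤ :=
    he.span_eq_top_of_card_eq_finrank' (Fintype.card_fin _)
  have hmem : (nabla.delta ^ Module.finrank K⸨X⸩ V) e ∈ Submodule.span K⸨X⸩
      (Set.range fun i : Fin (Module.finrank K⸨X⸩ V) => (nabla.delta ^ (i : ℕ)) e) := by
    rw [htop]; trivial
  obtain ⟨a, ha⟩ := (Submodule.mem_span_range_iff_exists_fun _).1 hmem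
  refine ⟨e, a, ?_, ha.symm⟩
  rw [eq_top_iff, ← htop]
  refine Submodule.span_mono ?_
  rintro _ ⟨i, rfl⟩
  exact ⟨i, rfl⟩

/-- A cyclic vector gives a basis of iterated derivatives. -/
theorem Connection.IsCyclicEquation.exists_basis {nabla : Connection K V} {e : V}
    {a : Fin (Module.finrank K⸨X⸩ V) → K⸨X⸩} (h : nabla.IsCyclicEquation e a) :
    ∃ b : Module.Basis (Fin (Module.finrank K⸨X⸩ V)) K⸨X⸩ V,
      ∀ i, b i = (nabla.delta ^ (i : ℕ)) e := by
  set n := Module.finrank K⸨X⸩ V with hn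
  set W := Submodule.span K⸨X⸩ (Set.range fun i : Fin n => (nabla.delta ^ (i : ℕ)) e) with hW
  have hsub : ∀ i < n, (nabla.delta ^ i) e ∈ W := fun i hi => Submodule.subset_span ⟨⟨i, hi⟩, rfl⟩
  -- the span of the first `n` derivatives is stable under `δ`
  have hstable : ∀ x ∈ W, nabla.delta x ∈ W := by
    intro x hx
    induction hx using Submodule.span_induction with
    | mem x hx =>
      obtain ⟨i, rfl⟩ := hx
      change nabla.delta ((nabla.delta ^ (i : ℕ)) e) ∈ W
      rw [← Module.End.mul_apply, ← pow_succ']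
      obtain hi | hi := Nat.lt_or_ge (i + 1) n
      · exact hsub _ hi
      · rw [show (i : ℕ) + 1 = n by lia, h.2]
        exact sum_mem fun j _ => Submodule.smul_mem _ _ (hsub j j.2)
    | zero => rw [map_zero]; exact zero_mem _
    | add x y _ _ hx hy => rw [map_add]; exact add_mem hx hy
    | smul f x hx' hx =>
      rw [nabla.isThetaLinear_delta]
      exact add_mem (Submodule.smul_mem _ _ hx') (Submodule.smul_mem _ _ hx)
  have he : e ∈ W := by
    obtain h0 | h0 := Nat.eq_zero_or_pos n
    · have : Subsingleton V := Module.finrank_zero_iff.1 (hn.symm.trans h0)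
      rw [Subsingleton.elim e 0]
      exact zero_mem _
    · exact hsub 0 h0
  have hall : ∀ i, (nabla.delta ^ i) e ∈ W := by
    intro i
    induction i with
    | zero => exact he
    | succ i ih => rw [pow_succ', Module.End.mul_apply]; exact hstable _ ih
  have htop : ⊤ ≤ W := by
    rw [← h.1, Submodule.span_le]
    rintro _ ⟨i, rfl⟩
    exact hall i
  exact ⟨basisOfTopLeSpanOfCardEqFinrank _ htop (Fintype.card_fin _), fun i => by simp⟩

end Cyclic

/-! ### The adjoint of a differential operator -/

section Adjoint

open Polynomial

variable {K : Type u} [Field K] {n : ℕ} (a : Fin n → K⸨X⸩)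

/-- The formal adjoint `f ↦ (-θ)ⁿ f - ∑ (-θ)ⁱ (aᵢ f)` of the operator `θⁿ - ∑ aᵢ θⁱ`, where
`θ = t d/dt`. -/
def adjointOp : K⸨X⸩ →ₗ[K] K⸨X⸩ :=
  (-theta K) ^ n - ∑ i : Fin n, ((-theta K) ^ (i : ℕ)) ∘ₗ LinearMap.mulLeft K (a i)

theorem adjointOp_apply (f : K⸨X⸩) :
    adjointOp a f = ((-theta K) ^ n) f - ∑ i : Fin n, ((-theta K) ^ (i : ℕ)) (a i * f) := by
  simp [adjointOp, LinearMap.sum_apply]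

theorem coeff_mem_fil_newtonHeight (i : Fin n) : a i ∈ fil K (-(newtonHeight a : ℤ)) := by
  refine fil_anti ?_ (mem_fil_order (a i))
  have : (-(a i).order).toNat ≤ newtonHeight a :=
    Finset.le_sup (f := fun i => (-(a i).order).toNat) (Finset.mem_univ i)
  lia

theorem adjointOp_mem_fil {k : ℤ} {f : K⸨X⸩} (hf : f ∈ fil K k) :
    adjointOp a f ∈ fil K (k - newtonHeight a) := by
  rw [adjointOp_apply]
  refine sub_mem (fil_anti (by lia) (neg_theta_pow_mem_fil n hf)) (sum_mem fun i _ => ?_)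
  refine neg_theta_pow_mem_fil i (fil_anti ?_ (mul_mem_fil (coeff_mem_fil_newtonHeight a i) hf))
  lia

/-- The polynomial that governs the action of `adjointOp a` on leading coefficients. -/
def indicialPolynomial : K[X] :=
  (if newtonHeight a = 0 then X ^ n else 0) -
    ∑ i : Fin n, monomial (i : ℕ) ((a i).coeff (-(newtonHeight a : ℤ)))

theorem indicialPolynomial_ne_zero : indicialPolynomial a ≠ 0 := by
  intro h
  have hcoeff : ∀ j, (∑ i : Fin n, monomial (i : ℕ) ((a i).coeff (-(newtonHeight a : ℤ)))).coeff j =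
      ∑ i : Fin n, if (i : ℕ) = j then (a i).coeff (-(newtonHeight a : ℤ)) else 0 := by
    intro j
    rw [finsetSum_coeff]
    exact Finset.sum_congr rfl fun i _ => coeff_monomial
  by_cases hr : newtonHeight a = 0
  · -- the leading term is `X ^ n`
    have h1 := congrArg (fun p => coeff p n) h
    simp only [indicialPolynomial, coeff_sub, hcoeff, coeff_zero] at h1
    rw [if_pos hr, coeff_X_pow_self, Finset.sum_eq_zero, sub_zero] at h1
    · exact one_ne_zero h1
    · intro i _
      rw [if_neg (by have := i.2; lia)]
  · -- some `a i` has order exactly `-newtonHeight a`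
    have hn : (Finset.univ : Finset (Fin n)).Nonempty := by
      by_contra hne
      rw [Finset.not_nonempty_iff_eq_empty] at hne
      exact hr (by rw [newtonHeight, hne]; rfl)
    obtain ⟨i, -, hi⟩ := Finset.exists_mem_eq_sup _ hn fun i => (-(a i).order).toNat
    have hi' : newtonHeight a = (-(a i).order).toNat := hi
    have h1 := congrArg (fun p => coeff p i) h
    simp only [indicialPolynomial, coeff_sub, hcoeff, coeff_zero] at h1
    rw [if_neg hr, coeff_zero, zero_sub, neg_eq_zero, Finset.sum_eq_single i, if_pos rfl,
      show -(newtonHeight a : ℤ) = (a i).order by lia, HahnSeries.coeff_order_eq_zero] at h1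
    · rw [h1, HahnSeries.order_zero] at hi'
      exact hr (by simpa using hi')
    · intro j _ hj
      rw [if_neg (fun h => hj (Fin.ext h))]
    · simp

theorem coeff_adjointOp {k : ℤ} {f : K⸨X⸩} (hf : f ∈ fil K k) :
    (adjointOp a f).coeff (k - newtonHeight a) =
      (indicialPolynomial a).eval ((newtonHeight a - k : ℤ) : K) * f.coeff k := by
  have hneg : -((k - newtonHeight a : ℤ) : K) = ((newtonHeight a - k : ℤ) : K) := by
    push_cast; ring
  rw [adjointOp_apply, HahnSeries.coeff_sub, HahnSeries.coeff_sum, coeff_neg_theta_pow, hneg]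
  simp only [coeff_neg_theta_pow, hneg, indicialPolynomial, eval_sub, eval_finsetSum,
    eval_monomial, sub_mul, Finset.sum_mul]
  congr 1
  · split_ifs with hr
    · simp [hr]
    · rw [hf _ (by lia), eval_zero, mul_zero, zero_mul]
  · refine Finset.sum_congr rfl fun i _ => ?_
    have := coeff_mul_of_mem_fil (coeff_mem_fil_newtonHeight a i) hf
    rw [show k - newtonHeight a = -(newtonHeight a : ℤ) + k by ring, this]
    ring

theorem exists_eval_indicialPolynomial_ne_zero [CharZero K] :
    ∃ N : ℤ, ∀ k < N, (indicialPolynomial a).eval ((newtonHeight a - k : ℤ) : K) ≠ 0 := by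
  classical
  have hinj : Function.Injective fun k : ℤ => ((newtonHeight a - k : ℤ) : K) := by
    intro k l h
    have := Int.cast_injective h
    lia
  obtain ⟨N, hN⟩ := ((indicialPolynomial a).roots.toFinset.finite_toSet.preimage
    hinj.injOn).bddBelow
  refine ⟨N, fun k hk h => hk.not_ge (hN ?_)⟩
  simpa [indicialPolynomial_ne_zero] using h

variable {a} {N : ℤ}
  (hN : ∀ k < N, (indicialPolynomial a).eval ((newtonHeight a - k : ℤ) : K) ≠ 0)

include hN

theorem mem_fil_of_adjointOp_mem_fil {f : K⸨X⸩} (hf : adjointOp a f ∈ fil K (N - newtonHeight a)) :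
    f ∈ fil K N := by
  by_contra h
  have hf0 : f ≠ 0 := by rintro rfl; exact h (zero_mem _)
  have hord : f.order < N := by
    by_contra hlt
    exact h (fil_anti (not_lt.1 hlt) (mem_fil_order f))
  have h1 := coeff_adjointOp a (mem_fil_order f)
  rw [hf _ (by lia), eq_comm, mul_eq_zero, HahnSeries.coeff_order_eq_zero] at h1
  exact h1.elim (hN _ hord) hf0

theorem exists_adjointOp_sub_mem_fil (y : K⸨X⸩) :
    ∃ f, adjointOp a f - y ∈ fil K (N - newtonHeight a) := by
  -- the coefficients of `y` below degree `N - newtonHeight a` are removed one by one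
  have key : ∀ (j : ℕ) (y : K⸨X⸩), y ∈ fil K (N - newtonHeight a - j) →
      ∃ f, adjointOp a f - y ∈ fil K (N - newtonHeight a) := by
    intro j
    induction j with
    | zero =>
      intro y hy
      refine ⟨0, ?_⟩
      rw [map_zero, zero_sub]
      exact neg_mem (by simpa using hy)
    | succ j ih =>
      intro y hy
      set k : ℤ := N - (j + 1 : ℕ) with hk
      have hk' : N - newtonHeight a - (j + 1 : ℕ) = k - newtonHeight a := by lia
      rw [hk'] at hy
      have hq := hN k (by lia)
      set q := (indicialPolynomial a).eval ((newtonHeight a - k : ℤ) : K)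
      let f₀ : K⸨X⸩ := HahnSeries.single k (y.coeff (k - newtonHeight a) / q)
      have hf₀ : f₀ ∈ fil K k := single_mem_fil _ _
      have h1 : y - adjointOp a f₀ ∈ fil K (k - newtonHeight a + 1) := by
        refine mem_fil_succ.2 ⟨sub_mem hy (adjointOp_mem_fil a hf₀), ?_⟩
        rw [HahnSeries.coeff_sub, coeff_adjointOp a hf₀, HahnSeries.coeff_single_same,
          mul_div_cancel₀ _ hq, sub_self]
      obtain ⟨f, hf⟩ := ih _ (by convert h1 using 2; lia)
      refine ⟨f + f₀, ?_⟩
      rw [map_add]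
      convert hf using 1
      ring
  refine key (N - newtonHeight a - y.order).toNat y (fil_anti ?_ (mem_fil_order y))
  lia

end Adjoint

/-! ### A connection in a cyclic basis -/

section CyclicBasis

variable {K : Type u} [Field K] {V : Type v} [AddCommGroup V] [Module K⸨X⸩ V]
  [Module K V] [IsScalarTower K K⸨X⸩ V] {m : ℕ} (b : Module.Basis (Fin (m + 1)) K⸨X⸩ V)
  {δ : V →ₗ[K] V} {a : Fin (m + 1) → K⸨X⸩}

/-- The functional `∑ xᵢ bᵢ ↦ ∑ (-θ)ⁱ xᵢ`. -/
def cyclicFunctional : V →ₗ[K] K⸨X⸩ :=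
  ∑ i : Fin (m + 1), ((-theta K) ^ (i : ℕ)) ∘ₗ (b.coord i).restrictScalars K

theorem cyclicFunctional_apply (x : V) :
    cyclicFunctional b x = ∑ i : Fin (m + 1), ((-theta K) ^ (i : ℕ)) (b.repr x i) := by
  simp [cyclicFunctional, LinearMap.sum_apply]

variable {b} (hδ : IsThetaLinear δ) (hb : ∀ i : Fin m, δ (b i.castSucc) = b i.succ)
  (hlast : δ (b (Fin.last m)) = ∑ i, a i • b i)

include hδ hb

/-- Modulo the image of `δ`, every vector is a multiple of the cyclic vector. -/
theorem sub_cyclicFunctional_smul_mem_range (y : V) :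
    y - cyclicFunctional b y • b 0 ∈ LinearMap.range δ := by
  have key : ∀ (i : Fin (m + 1)) (g : K⸨X⸩),
      g • b i - ((-theta K) ^ (i : ℕ)) g • b 0 ∈ LinearMap.range δ := by
    intro i
    induction i using Fin.induction with
    | zero => intro g; simp
    | succ i ih =>
      intro g
      have h1 := add_mem (ih (-theta K g)) (⟨g • b i.castSucc, rfl⟩ : _ ∈ LinearMap.range δ)
      rw [hδ, hb] at h1
      convert h1 using 1
      rw [Fin.val_succ, pow_succ, Module.End.mul_apply, LinearMap.neg_apply, Fin.val_castSucc,
        neg_smul]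
      abel
  have h : y - cyclicFunctional b y • b 0 =
      ∑ i : Fin (m + 1), (b.repr y i • b i - ((-theta K) ^ (i : ℕ)) (b.repr y i) • b 0) := by
    rw [Finset.sum_sub_distrib, b.sum_repr, cyclicFunctional_apply, Finset.sum_smul]
  rw [h]
  exact sum_mem fun i _ => key i _

include hlast

omit [IsScalarTower K K⸨X⸩ V] in
theorem repr_delta (x : V) (j : Fin (m + 1)) :
    b.repr (δ x) j = theta K (b.repr x j) +
      (∑ i : Fin m, if i.succ = j then b.repr x i.castSucc else 0) +
      a j * b.repr x (Fin.last m) := by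
  have h : δ x = ∑ i, theta K (b.repr x i) • b i +
      (∑ i : Fin m, b.repr x i.castSucc • b i.succ) +
      ∑ i, (b.repr x (Fin.last m) * a i) • b i := by
    conv_lhs => rw [← b.sum_repr x]
    rw [map_sum]
    simp only [hδ _ _, Finset.sum_add_distrib]
    rw [add_assoc]
    congr 1
    rw [Fin.sum_univ_castSucc, hlast, Finset.smul_sum]
    simp only [hb, smul_smul]
  rw [h, map_add, map_add, Finsupp.add_apply, Finsupp.add_apply, Module.Basis.repr_sum_self,
    Module.Basis.repr_sum_self, mul_comm (a j)]
  congr 2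
  simp [Finsupp.finsetSum_apply, Finsupp.single_apply]

omit [IsScalarTower K K⸨X⸩ V] in
theorem repr_delta_zero (x : V) :
    b.repr (δ x) 0 = theta K (b.repr x 0) + a 0 * b.repr x (Fin.last m) := by
  rw [repr_delta hδ hb hlast]
  simp [Fin.succ_ne_zero]

omit [IsScalarTower K K⸨X⸩ V] in
theorem repr_delta_succ (x : V) (i : Fin m) :
    b.repr (δ x) i.succ = theta K (b.repr x i.succ) + b.repr x i.castSucc +
      a i.succ * b.repr x (Fin.last m) := by
  rw [repr_delta hδ hb hlast]
  simp [Fin.succ_inj]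

theorem cyclicFunctional_delta (x : V) :
    cyclicFunctional b (δ x) = -adjointOp a (b.repr x (Fin.last m)) := by
  have h1 : ∀ (j : ℕ) (f : K⸨X⸩), ((-theta K) ^ j) (theta K f) = -((-theta K) ^ (j + 1)) f := by
    intro j f
    rw [pow_succ, Module.End.mul_apply, LinearMap.neg_apply, map_neg, neg_neg]
  rw [cyclicFunctional_apply, adjointOp_apply]
  have h2 : ∀ j : Fin (m + 1), ((-theta K) ^ (j : ℕ)) (b.repr (δ x) j) =
      -((-theta K) ^ ((j : ℕ) + 1)) (b.repr x j) +
      ((-theta K) ^ (j : ℕ))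
        (∑ i : Fin m, if i.succ = j then b.repr x i.castSucc else 0) +
      ((-theta K) ^ (j : ℕ)) (a j * b.repr x (Fin.last m)) := by
    intro j
    rw [repr_delta hδ hb hlast, map_add, map_add, h1]
  simp only [h2, Finset.sum_add_distrib]
  rw [Fin.sum_univ_castSucc (fun j : Fin (m + 1) => -((-theta K) ^ ((j : ℕ) + 1)) (b.repr x j)),
    Fin.sum_univ_succ (fun j : Fin (m + 1) => ((-theta K) ^ (j : ℕ))
      (∑ i : Fin m, if i.succ = j then b.repr x i.castSucc else 0))]
  simp only [Fin.succ_ne_zero, Fin.succ_inj, Finset.sum_ite_eq', Finset.mem_univ, if_true, if_false,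
    Finset.sum_const_zero, map_zero, zero_add, Fin.val_castSucc, Fin.val_succ, Fin.val_last,
    Finset.sum_neg_distrib]
  abel

theorem adjointOp_smul_mem_range (f : K⸨X⸩) : adjointOp a f • b 0 ∈ LinearMap.range δ := by
  have h1 := sub_cyclicFunctional_smul_mem_range hδ hb (δ (f • b (Fin.last m)))
  rw [cyclicFunctional_delta hδ hb hlast] at h1
  simp only [map_smul, Module.Basis.repr_self, Finsupp.smul_single, smul_eq_mul, mul_one,
    Finsupp.single_eq_same, neg_smul, sub_neg_eq_add] at h1
  simpa using sub_mem h1 (⟨f • b (Fin.last m), rfl⟩ : _ ∈ LinearMap.range δ)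

/-- The last coordinate is allowed `newtonHeight a` fewer polar terms than the other ones; then
`δ` identifies `V` modulo this lattice with `V` modulo a multiple of the standard lattice. -/
theorem delta_bijective_of_cyclic_basis [CharZero K] : ∃ N : ℤ,
    (∀ x, x ∈ box b (fun i => if (i : ℕ) + 1 = m + 1 then N else N - newtonHeight a) ↔
      δ x ∈ box b fun _ => N - newtonHeight a) ∧
    ∀ y, ∃ x, δ x - y ∈ box b fun _ => N - newtonHeight a := by
  obtain ⟨N, hN⟩ := exists_eval_indicialPolynomial_ne_zero a
  set r : ℤ := (newtonHeight a : ℤ) with hr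
  have hmul : ∀ (j : Fin (m + 1)) {f : K⸨X⸩}, f ∈ fil K N → a j * f ∈ fil K (N - r) :=
    fun j f hf => fil_anti (by lia) (mul_mem_fil (coeff_mem_fil_newtonHeight a j) hf)
  have hbox : ∀ x, x ∈ box b (fun i => if (i : ℕ) + 1 = m + 1 then N else N - r) ↔
      b.repr x (Fin.last m) ∈ fil K N ∧ ∀ i : Fin m, b.repr x i.castSucc ∈ fil K (N - r) := by
    intro x
    rw [mem_box, Fin.forall_fin_succ']
    simp [and_comm, Fin.is_lt, ne_of_lt]
  refine ⟨N, fun x => ?_, fun y => ?_⟩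
  · rw [hbox]
    constructor
    · rintro ⟨h1, h2⟩
      have h3 : ∀ j, b.repr x j ∈ fil K (N - r) := by
        intro j
        refine Fin.lastCases (fil_anti (by lia) h1) (fun i => h2 i) j
      rw [mem_box]
      intro j
      refine Fin.cases ?_ (fun i => ?_) j
      · rw [repr_delta_zero hδ hb hlast]
        exact add_mem (theta_mem_fil (h3 0)) (hmul _ h1)
      · rw [repr_delta_succ hδ hb hlast]
        exact add_mem (add_mem (theta_mem_fil (h3 _)) (h2 i)) (hmul _ h1)
    · intro h
      rw [mem_box] at h
      have h1 : b.repr x (Fin.last m) ∈ fil K N := by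
        refine mem_fil_of_adjointOp_mem_fil hN ?_
        have h2 := cyclicFunctional_delta hδ hb hlast x
        rw [eq_comm, neg_eq_iff_eq_neg, cyclicFunctional_apply] at h2
        rw [h2]
        exact neg_mem (sum_mem fun i _ => neg_theta_pow_mem_fil _ (h i))
      -- the other coordinates are recovered from the last one by descending induction
      have h2 : ∀ j, b.repr x j ∈ fil K (N - r) := by
        intro j
        induction j using Fin.reverseInduction with
        | last => exact fil_anti (by lia) h1
        | cast i ih =>
          have h3 := repr_delta_succ hδ hb hlast x i
          have h4 : b.repr x i.castSucc = b.repr (δ x) i.succ - theta K (b.repr x i.succ) -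
              a i.succ * b.repr x (Fin.last m) := by
            rw [h3]; ring
          rw [h4]
          exact sub_mem (sub_mem (h _) (theta_mem_fil ih)) (hmul _ h1)
      exact ⟨h1, fun i => h2 _⟩
  · obtain ⟨f, hf⟩ := exists_adjointOp_sub_mem_fil hN (cyclicFunctional b y)
    obtain ⟨x, hx⟩ := add_mem (sub_cyclicFunctional_smul_mem_range hδ hb y)
      (adjointOp_smul_mem_range hδ hb hlast f)
    refine ⟨x, ?_⟩
    have h1 : δ x - y = (adjointOp a f - cyclicFunctional b y) • b 0 := by
      rw [hx, sub_smul]; abel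
    rw [h1]
    exact smul_basis_mem_box b hf 0 le_rfl

end CyclicBasis

/-! ### The index of the covariant derivative on `V / L` -/

section Index

variable {K : Type u} [Field K] {V : Type v} [AddCommGroup V] [Module K⸨X⸩ V]
  [Module K V] [IsScalarTower K K⸨X⸩ V] {nabla : Connection K V}

omit [IsScalarTower K K⸨X⸩ V] in
theorem finiteDimensional_ker_factor {L M : Submodule K V} (h : L ≤ M)
    (hL : IsOpenSubspace K L) (hM : IsBoundedSubspace K M) :
    FiniteDimensional K (LinearMap.ker (Submodule.factor h)) := by
  rw [ker_factor]
  exact hM L hL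

omit [IsScalarTower K K⸨X⸩ V] in
/-- The operator on `V / L'` that represents the asymptotic operator of `g` is, up to projections
with finite-dimensional kernels, the map `V / L → V / M` induced by `g`; if the latter is
bijective, the index is `dim L / L₀ + dim M' / M - dim M' / L₀` for a sufficiently small lattice
`L₀` and a sufficiently large lattice `M'`. -/
theorem hasIndex_section_of_bijective {L₀ L L' M M' : Submodule K V} {g : V →ₗ[K] V}
    {s : V ⧸ L' →ₗ[K] V} (hs : L'.mkQ ∘ₗ s = LinearMap.id)
    (h₀ : L₀ ≤ L) (h₀' : L₀ ≤ L') (hM : M ≤ M') (hL' : L' ≤ M') (hg : L' ≤ M'.comap g)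
    (hLM : L ≤ M.comap g) (hbij : Function.Bijective (L.mapQ M g hLM))
    (o₀ : IsOpenSubspace K L₀) (o' : IsOpenSubspace K L') (bM' : IsBoundedSubspace K M')
    {dL dM d : ℤ}
    (iL : HasIndex (Submodule.factor h₀) dL) (iM : HasIndex (Submodule.factor hM) dM)
    (i : HasIndex (Submodule.factor (h₀'.trans hL')) d)
    (bL' : IsBoundedSubspace K L') :
    HasIndex (L'.mkQ ∘ₗ g ∘ₗ s) (dL + dM - d) := by
  have k1 := finiteDimensional_ker_factor h₀' o₀ bL'
  have k2 := finiteDimensional_ker_factor hL' o' bM'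
  have kL := iL.finite_ker
  have kM := iM.finite_ker
  have eL := iL.unique (hasIndex_of_surjective (Submodule.factor_surjective h₀))
  have eM := iM.unique (hasIndex_of_surjective (Submodule.factor_surjective hM))
  have hcomp : Submodule.factor hL' ∘ₗ Submodule.factor h₀' =
      Submodule.factor (h₀'.trans hL') := Submodule.factor_comp _ _
  rw [← hcomp, hasIndex_comp_surjective _ (Submodule.factor_surjective h₀')] at i
  have e := i.unique (hasIndex_of_surjective (Submodule.factor_surjective hL'))
  have hsq : Submodule.factor hL' ∘ₗ (L'.mkQ ∘ₗ g ∘ₗ s) ∘ₗ Submodule.factor h₀' =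
      Submodule.factor hM ∘ₗ L.mapQ M g hLM ∘ₗ Submodule.factor h₀ := by
    refine LinearMap.ext fun x => ?_
    obtain ⟨x, rfl⟩ := L₀.mkQ_surjective x
    have hx : s (L'.mkQ x) - x ∈ L' :=
      (Submodule.Quotient.eq L').1 (LinearMap.congr_fun hs (L'.mkQ x))
    have hgx : g (s (L'.mkQ x)) - g x ∈ M' := by
      rw [← map_sub]
      exact hg hx
    exact (Submodule.Quotient.eq M').2 hgx
  have h1 : HasIndex (Submodule.factor hM ∘ₗ L.mapQ M g hLM ∘ₗ Submodule.factor h₀) (dL + dM) := by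
    rw [hasIndex_surjective_comp _ (Submodule.factor_surjective hM),
      hasIndex_comp_surjective _ (Submodule.factor_surjective h₀), ← eM, ← eL]
    convert hasIndex_of_bijective hbij using 1
    ring
  rw [← hsq, hasIndex_surjective_comp _ (Submodule.factor_surjective hL'),
    hasIndex_comp_surjective _ (Submodule.factor_surjective h₀')] at h1
  convert h1 using 1
  linarith

/-- `delta_bijective_of_cyclic_basis` for a cyclic vector, with the zero-dimensional case
included. -/
theorem Connection.IsCyclicEquation.delta_bijective [CharZero K] [FiniteDimensional K⸨X⸩ V] {e : V}
    {a : Fin (Module.finrank K⸨X⸩ V) → K⸨X⸩} (h : nabla.IsCyclicEquation e a)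
    {b : Module.Basis (Fin (Module.finrank K⸨X⸩ V)) K⸨X⸩ V}
    (hb : ∀ i, b i = (nabla.delta ^ (i : ℕ)) e) : ∃ N : ℤ,
    (∀ x, x ∈ box b (fun i => if (i : ℕ) + 1 = Module.finrank K⸨X⸩ V then N
        else N - newtonHeight a) ↔ nabla.delta x ∈ box b fun _ => N - newtonHeight a) ∧
    ∀ y, ∃ x, nabla.delta x - y ∈ box b fun _ => N - newtonHeight a := by
  have h2 := h.2
  clear h
  generalize Module.finrank K⸨X⸩ V = n at a b hb h2
  cases n with
  | zero => exact ⟨0, fun x => by simp [mem_box], fun y => ⟨0, by simp [mem_box]⟩⟩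
  | succ m =>
    refine delta_bijective_of_cyclic_basis nabla.isThetaLinear_delta (fun i => ?_) ?_
    · rw [hb, hb, Fin.val_succ, pow_succ', Module.End.mul_apply, Fin.val_castSucc]
    · rw [hb, Fin.val_last, ← Module.End.mul_apply, ← pow_succ', h2]
      simp only [hb]

/-- `∇(τ_ν)` is `w δ` with `w` of order exactly `-(v(ν) + 1)`, the inverse `w'` witnessing that the
order is not larger. -/
theorem exists_along_tau_eq_smul_delta {ν : Form K} (hν : ν ≠ 0) :
    ∃ w w' : K⸨X⸩, w * w' = 1 ∧ w ∈ fil K (-(ν.valuation + 1)) ∧ w' ∈ fil K (ν.valuation + 1) ∧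
      ∀ (nabla : Connection K V) (x : V), nabla.along (tau ν) x = w • nabla.delta x := by
  have hc : coeffDt K ν ≠ 0 := by simpa using hν
  have hs : (HahnSeries.single 1 1 : K⸨X⸩) * HahnSeries.single (-1) 1 = 1 := by
    rw [HahnSeries.single_mul_single, add_neg_cancel, mul_one]; rfl
  have hinv : ((coeffDt K ν)⁻¹).order = -ν.valuation := by
    have := HahnSeries.order_mul hc (inv_ne_zero hc)
    rw [mul_inv_cancel₀ hc, HahnSeries.order_one] at this
    change 0 = ν.valuation + _ at this
    lia
  refine ⟨(coeffDt K ν)⁻¹ * HahnSeries.single (-1) 1, coeffDt K ν * HahnSeries.single 1 1,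
    ?_, ?_, ?_, fun nabla x => nabla.along_tau ν x⟩
  · calc _ = ((coeffDt K ν)⁻¹ * coeffDt K ν) *
        (HahnSeries.single 1 1 * HahnSeries.single (-1) 1) := by ring
      _ = 1 := by rw [hs, inv_mul_cancel₀ hc, one_mul]
  · rw [neg_add, ← hinv]
    exact mul_mem_fil (mem_fil_order _) (single_mem_fil _ _)
  · exact mul_mem_fil (mem_fil_order _) (single_mem_fil _ _)

theorem sum_ite_last_newtonHeight {n : ℕ} (a : Fin n → K⸨X⸩) :
    ∑ i : Fin n, (if (i : ℕ) + 1 = n then (newtonHeight a : ℤ) else 0) = newtonHeight a := by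
  cases n with
  | zero => simp [newtonHeight]
  | succ m => rw [Fin.sum_univ_castSucc]; simp [ne_of_lt]

/-- The index of the covariant derivative on `V / L'`. -/
theorem Connection.IsCyclicEquation.hasIndex [CharZero K] [FiniteDimensional K⸨X⸩ V] {e : V}
    {a : Fin (Module.finrank K⸨X⸩ V) → K⸨X⸩} (h : nabla.IsCyclicEquation e a)
    {ν : Form K} (hν : ν ≠ 0) {L' : Submodule K V} (hL' : IsCLattice K L')
    {s : V ⧸ L' →ₗ[K] V} (hs : L'.mkQ ∘ₗ s = LinearMap.id) :
    HasIndex (L'.mkQ ∘ₗ nabla.along (tau ν) ∘ₗ s)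
      (-(newtonHeight a + (ν.valuation + 1) * Module.finrank K⸨X⸩ V)) := by
  obtain ⟨b, hb⟩ := h.exists_basis
  obtain ⟨N, hmem, hsurj⟩ := h.delta_bijective hb
  obtain ⟨w, w', hww, hw, hw', hτ⟩ := exists_along_tau_eq_smul_delta (V := V) hν
  have hsum' := sum_ite_last_newtonHeight a
  set r : ℤ := (newtonHeight a : ℤ) with hr
  set v := ν.valuation + 1 with hv
  set c : Fin (Module.finrank K⸨X⸩ V) → ℤ := fun i =>
    if (i : ℕ) + 1 = Module.finrank K⸨X⸩ V then N else N - r with hc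
  -- `L = box b c` and `M = w • box b (N - r)`
  have hsum : ∑ i, c i = Module.finrank K⸨X⸩ V * (N - r) + r := by
    have h1 : ∀ i, c i = (N - r) + if (i : ℕ) + 1 = Module.finrank K⸨X⸩ V then r else 0 := by
      intro i; simp only [hc]; split_ifs <;> ring
    simp only [h1, Finset.sum_add_distrib, Finset.sum_const, Finset.card_univ, Fintype.card_fin,
      nsmul_eq_mul, hsum']
  have hM : ∀ y, y ∈ box b (fun _ => N - r) ↔ w • y ∈ box b (fun _ => -v + (N - r)) := by
    refine fun y => ⟨fun hy => smul_mem_box hw hy, fun hy => ?_⟩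
    have := smul_mem_box hw' hy
    rw [smul_smul, mul_comm, hww, one_smul] at this
    simpa using this
  have hLM : ∀ x, x ∈ box b c ↔ nabla.along (tau ν) x ∈ box b (fun _ => -v + (N - r)) := by
    intro x
    rw [hmem, hM, hτ]
  have hbij : Function.Bijective ((box b c).mapQ (box b fun _ => -v + (N - r))
      (nabla.along (tau ν)) fun x hx => (hLM x).1 hx) := by
    refine mapQ_bijective _ (fun x hx => (hLM x).2 hx) fun y => ?_
    obtain ⟨x, hx⟩ := hsurj (w' • y)
    refine ⟨x, ?_⟩
    rw [hM, smul_sub, smul_smul, hww, one_smul] at hx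
    rwa [hτ]
  -- the small lattice `box b p` and the large lattice `box b q`
  obtain ⟨p₀, hp₀⟩ := hL'.1.exists_box_le b
  obtain ⟨q₀, hq₀⟩ := hL'.2.exists_le_box b
  obtain ⟨q₁, hq₁⟩ := nabla.isThetaLinear_delta.exists_map_box_le b q₀
  obtain ⟨p, hp1, hp2⟩ : ∃ p : ℤ, p₀ ≤ p ∧ N ≤ p := ⟨_, le_max_left _ _, le_max_right _ _⟩
  obtain ⟨q, hq1, hq2, hq3, hq4⟩ : ∃ q : ℤ, q ≤ q₀ ∧ q ≤ -v + q₁ ∧ q ≤ -v + (N - r) ∧ q ≤ p :=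
    ⟨min (min q₀ (-v + q₁)) (min (-v + (N - r)) p), by lia, by lia, by lia, by lia⟩
  have hcp : c ≤ fun _ => p := by
    intro i
    simp only [hc]
    split_ifs <;> lia
  have hg : L' ≤ (box b fun _ => q).comap (nabla.along (tau ν)) := by
    intro x hx
    rw [Submodule.mem_comap, hτ]
    exact box_anti b (fun _ => hq2) (smul_mem_box hw (hq₁ x (hq₀ _ le_rfl hx)))
  have key := hasIndex_section_of_bijective hs (box_anti b hcp) (hp₀ p hp1)
    (box_anti b fun _ => hq3) (hq₀ q hq1) hg _ hbij (isOpenSubspace_box b _) hL'.1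
    (isBoundedSubspace_box b _) (hasIndex_factor_box b hcp)
    (hasIndex_factor_box b (c := fun _ => q) fun _ => hq3)
    (hasIndex_factor_box b (c := fun _ => q) fun _ => hq4) hL'.2
  convert key using 1
  simp only [Finset.sum_sub_distrib, hsum, Finset.sum_const, Finset.card_univ, Fintype.card_fin,
    nsmul_eq_mul]
  ring

/-- The degree of the `ε`-line, computed with a cyclic vector. -/
theorem Connection.IsCyclicEquation.epsilonLine_degree [CharZero K] [FiniteDimensional K⸨X⸩ V]
    {e : V} {a : Fin (Module.finrank K⸨X⸩ V) → K⸨X⸩} (h : nabla.IsCyclicEquation e a)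
    {ν : Form K} (hν : ν ≠ 0) {L : Submodule K V} (hL : IsCLattice K L) :
    ∃ hiso : (nabla.tauInfty ν L).IsIso, (nabla.epsilonLine ν L hiso).degree =
      newtonHeight a + (ν.valuation + 1) * Module.finrank K⸨X⸩ V := by
  have hi := h.hasIndex hν hL
    (L.mkQ.exists_rightInverse_of_surjective L.range_mkQ).choose_spec
  refine ⟨hi.isIso, ?_⟩
  exact (relDet_degree hi _).trans (neg_neg _)

theorem exists_isCLattice [FiniteDimensional K⸨X⸩ V] : ∃ L : Submodule K V, IsCLattice K L :=
  ⟨_, isCLattice_box (Module.finBasis K⸨X⸩ V) fun _ => 0⟩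

/-- All cyclic vectors give the same Newton height, since it is determined by the degree of the
`ε`-line. -/
theorem Connection.IsCyclicEquation.newtonHeight_eq_irregularity [CharZero K]
    [FiniteDimensional K⸨X⸩ V] {e : V} {a : Fin (Module.finrank K⸨X⸩ V) → K⸨X⸩}
    (h : nabla.IsCyclicEquation e a) : newtonHeight a = nabla.irregularity := by
  have hset : {r | ∃ e a, nabla.IsCyclicEquation e a ∧ r = newtonHeight a} =
      {newtonHeight a} := by
    refine Set.eq_singleton_iff_unique_mem.2 ⟨⟨e, a, h, rfl⟩, ?_⟩
    rintro _ ⟨e', a', h', rfl⟩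
    obtain ⟨L, hL⟩ := exists_isCLattice (K := K) (V := V)
    have hν : dlogT K ≠ 0 := by simp [dlogT]
    obtain ⟨_, h1⟩ := h.epsilonLine_degree hν hL
    obtain ⟨_, h2⟩ := h'.epsilonLine_degree hν hL
    have h3 := h2.symm.trans h1
    lia
  rw [Connection.irregularity, hset, csInf_singleton]

end Index

end EpsilonLine

end

/-- The irregularity is well defined by cyclic vectors (first two clauses), c-lattices exist, and
for every c-lattice `L` the operator `∇(τ_ν)^∞` on `V^∞ = (V / L)^∞` is invertible and
the `ε`-line has the asserted degree. -/
theorem corollary4p3 {K : Type*} [Field K] [CharZero K] {V : Type*} [AddCommGroup V]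
    [Module K⸨X⸩ V] [Module K V] [IsScalarTower K K⸨X⸩ V] [FiniteDimensional K⸨X⸩ V]
    (nabla : EpsilonLine.Connection K V) (ν : EpsilonLine.Form K) (hν : ν ≠ 0) :
    (∃ e a, nabla.IsCyclicEquation e a) ∧
    (∀ e a, nabla.IsCyclicEquation e a →
      EpsilonLine.newtonHeight a = nabla.irregularity) ∧
    (∃ L : Submodule K V, EpsilonLine.IsCLattice K L) ∧
    ∀ L : Submodule K V, EpsilonLine.IsCLattice K L →
      ∃ h : (nabla.tauInfty ν L).IsIso,
        (nabla.epsilonLine ν L h).degree =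
          (nabla.irregularity : ℤ) + (ν.valuation + 1) * Module.finrank K⸨X⸩ V := by
  obtain ⟨e, a, hea⟩ := nabla.exists_isCyclicEquation
  refine ⟨⟨e, a, hea⟩, fun e a h => h.newtonHeight_eq_irregularity,
    EpsilonLine.exists_isCLattice, fun L hL => ?_⟩
  rw [← hea.newtonHeight_eq_irregularity]
  exact hea.epsilonLine_degree hν hL
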